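/- Let $A$ be a finite-dimensional central simple algebra over a field $F$, and let $K\subseteq A$ be a field containing $F$ such that $K/F$ is Galois with abelian Galois group $G=\mathrm{Gal}(K/F)$. Let $C_A(K)$ be the centralizer of $K$ in $A$. Let $\Gamma$ be a totally ordered abelian (additive) group and $\varepsilon:\Gamma\to G$ a surjective homomorphism. For every $\sigma\in G$ choose $u_\sigma\in A^\times$ with $u_\sigma^{-1}xu_\sigma=\sigma(x)$ for all $x\in K$, and $u_{\mathrm{id}}=1$. Let $\mathcal D=C_A(K)((\Gamma))$ be the Malcev–Neumann ring of formal series $\sum_{\gamma\in\Gamma}a_\gamma r_\gamma$ with $r_\gamma\in C_A(K)$ and well-ordered support $\{\gamma\in\Gamma : r_\gamma\ne0\}$, with componentwise addition and with the multiplication determined by $$r\,a_\gamma=a_\gamma\,(u_{\varepsilon(\gamma)}^{-1}\,r\,u_{\varepsilon(\gamma)})\quad(r\in C_A(K)),\qquad a_\gamma a_\delta=a_{\gamma+\delta}\,u_{\varepsilon(\gamma)\varepsilon(\delta)}^{-1}u_{\varepsilon(\gamma)}u_{\varepsilon(\delta)}\qquad(\gamma,\delta\in\Gamma).$$ Let $F((\ker\varepsilon))\subseteq\mathcal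 D$ be the subring of series with all $r_\gamma\in F$ and support contained in $\ker\varepsilon$. Let $v:\mathcal D\to\Gamma\cup\{\infty\}$ be the map with $v(0)=\infty$ and $v(x)=\min\{\gamma : r_\gamma\neq0\}$ for $x=\sum a_\gamma r_\gamma\ne0$. For a subfield $L\subseteq\mathcal D$ let $\overline L\subseteq C_A(K)$ be its residue field, that is, the set of coefficients $r_0$ of the elements $\sum a_\gamma r_\gamma\in L$ with $v\ge0$. A subfield of a ring is a subring that is a (commutative) field, and a maximal subfield is one that is not properly contained in another subfield. Suppose that $C_A(K)$ is a division algebra and that $L$ is a maximal subfield of $\mathcal D$. Then the compositum $\overline LK$ is a maximal subfield of $C_A(K)$. If moreover $L/F((\ker\varepsilon))$ is a Galois extension and $\mathrm{char}\,F$ does not divide $[\overline L:F]$, then $\overline LK/F$ is a Galois extension. -/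

import Mathlib

set_option linter.unusedSectionVars false

/-! ### Division algebras, maximal subfields and Galois extensions inside a ring -/

/-- A (not necessarily commutative) ring is a division ring: it is nontrivial and every nonzero
element has a two-sided inverse. -/
def IsDivisionAlgebra (D : Type*) [Ring D] : Prop :=
  Nontrivial D ∧ ∀ x : D, x ≠ 0 → IsUnit x

/-- `L` is a maximal subfield of `D`: it is a (commutative) field, and it is not properly contained
in another subring of `D` that is a field. -/
def IsMaximalSubfield {D : Type*} [Ring D] (L : Subring D) : Prop :=
  Maximal (fun M : Subring D => IsField M) L

/-- `M / k` is a Galois extension of fields, for two subrings `k` and `M` of a ring `D`: they are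
fields, `k ⊆ M`, and `M` is Galois over `k` with respect to the inclusion. -/
def IsGaloisSubextension {D : Type*} [Ring D] (k M : Subring D) : Prop :=
  ∃ (hkM : k ≤ M) (hk : IsField k) (hM : IsField M),
    letI : Field k := hk.toField
    letI : Field M := hM.toField
    letI : Algebra k M := RingHom.toAlgebra (Subring.inclusion hkM)
    IsGalois k M

/-! ### The centralizer and the conjugating units -/

section Construction

open scoped Pointwise

variable {F K A : Type*} [Field F] [Field K] [Algebra F K] [Ring A] [Algebra F A]

/-- The centralizer `C_A(K)` of (the image of) `K` in `A`. -/
abbrev fieldCentralizer (ι : K →ₐ[F] A) : Subalgebra F A :=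
  Subalgebra.centralizer F (Set.range ι)

/-- `K`, regarded as a subring of `C_A(K)`. -/
def fieldInCentralizer (ι : K →ₐ[F] A) : Subring (fieldCentralizer ι) :=
  Subring.comap (fieldCentralizer ι).val.toRingHom ι.range.toSubring

/-- `F`, regarded as a subring of `C_A(K)`. -/
def baseInCentralizer (ι : K →ₐ[F] A) : Subring (fieldCentralizer ι) :=
  (algebraMap F (fieldCentralizer ι)).range

/-- A choice, for every `σ ∈ Gal(K/F)`, of a unit `u_σ` of `A` with `u_σ⁻¹ x u_σ = σ x` for all
`x ∈ K`, normalized by `u_id = 1`. -/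
structure ConjugatingUnits (ι : K →ₐ[F] A) where
  /-- the unit `u_σ` -/
  u : Gal(K/F) → Aˣ
  u_one : u 1 = 1
  conj_eq : ∀ (σ : Gal(K/F)) (x : K), (↑(u σ)⁻¹ : A) * ι x * (u σ : A) = ι (σ x)

namespace ConjugatingUnits

variable {ι : K →ₐ[F] A} (d : ConjugatingUnits ι)

theorem mem_iff {a : A} : a ∈ fieldCentralizer ι ↔ ∀ x : K, ι x * a = a * ι x := by
  simp [Subalgebra.mem_centralizer_iff]

theorem comm_u (σ : Gal(K/F)) (x : K) : ι x * (d.u σ : A) = (d.u σ : A) * ι (σ x) := by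
  rw [← d.conj_eq, mul_assoc, Units.mul_inv_cancel_left]

theorem comm_u_inv (σ : Gal(K/F)) (x : K) :
    (↑(d.u σ)⁻¹ : A) * ι x = ι (σ x) * (↑(d.u σ)⁻¹ : A) := by
  rw [← d.conj_eq, Units.mul_inv_cancel_right]

/-- `u_σ⁻¹ r u_σ`, which lies in `C_A(K)` when `r` does. -/
def conj (σ : Gal(K/F)) (r : fieldCentralizer ι) : fieldCentralizer ι :=
  ⟨(↑(d.u σ)⁻¹ : A) * r * (d.u σ : A), by
    rw [mem_iff]
    intro x
    obtain ⟨y, rfl⟩ := σ.surjective x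
    have h := mem_iff.1 r.2 y
    calc ι (σ y) * ((↑(d.u σ)⁻¹ : A) * r * (d.u σ : A))
        = (ι (σ y) * (↑(d.u σ)⁻¹ : A)) * r * (d.u σ : A) := by simp only [mul_assoc]
      _ = (↑(d.u σ)⁻¹ : A) * (ι y * r) * (d.u σ : A) := by
          rw [← d.comm_u_inv]; simp only [mul_assoc]
      _ = (↑(d.u σ)⁻¹ : A) * r * (ι y * (d.u σ : A)) := by rw [h]; simp only [mul_assoc]
      _ = (↑(d.u σ)⁻¹ : A) * r * (d.u σ : A) * ι (σ y) := by
          rw [d.comm_u]; simp only [mul_assoc]⟩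

variable [IsMulCommutative Gal(K/F)]

/-- `u_{στ}⁻¹ u_σ u_τ`, which lies in `C_A(K)` because `Gal(K/F)` is abelian. -/
def cocycle (σ τ : Gal(K/F)) : fieldCentralizer ι :=
  ⟨(↑(d.u (σ * τ))⁻¹ : A) * (d.u σ : A) * (d.u τ : A), by
    rw [mem_iff]
    intro x
    obtain ⟨y, rfl⟩ := (σ * τ).surjective x
    have hc : (σ * τ) y = τ (σ y) := by
      have := (IsMulCommutative.is_comm (M := Gal(K/F))).comm σ τ
      rw [this]; rfl
    calc ι ((σ * τ) y) * ((↑(d.u (σ * τ))⁻¹ : A) * (d.u σ : A) * (d.u τ : A))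
        = (ι ((σ * τ) y) * (↑(d.u (σ * τ))⁻¹ : A)) * ((d.u σ : A) * (d.u τ : A)) := by
          simp only [mul_assoc]
      _ = (↑(d.u (σ * τ))⁻¹ : A) * ((ι y * (d.u σ : A)) * (d.u τ : A)) := by
          rw [← d.comm_u_inv]; simp only [mul_assoc]
      _ = (↑(d.u (σ * τ))⁻¹ : A) * ((d.u σ : A) * (ι (σ y) * (d.u τ : A))) := by
          rw [d.comm_u]; simp only [mul_assoc]
      _ = (↑(d.u (σ * τ))⁻¹ : A) * (d.u σ : A) * (d.u τ : A) * ι ((σ * τ) y) := by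
          rw [d.comm_u, hc]; simp only [mul_assoc]⟩

end ConjugatingUnits

/-! ### The Malcev-Neumann ring -/

variable {Γ : Type*} [AddCommGroup Γ] [LinearOrder Γ] [IsOrderedAddMonoid Γ]

/-- The Malcev-Neumann ring `C_A(K)((Γ))`: formal series `∑ a_γ r_γ` with coefficients
`r_γ ∈ C_A(K)` and well-ordered support (a Hahn series, seen as an additive group only). The
multiplication, which depends on `d` and `ε`, is defined below. -/
@[ext]
structure MalcevNeumann {ι : K →ₐ[F] A} (d : ConjugatingUnits ι)
    (ε : Γ →+ Additive Gal(K/F)) where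
  /-- the underlying family of coefficients `γ ↦ r_γ` -/
  series : HahnSeries Γ (fieldCentralizer ι)

namespace MalcevNeumann

variable {ι : K →ₐ[F] A} {d : ConjugatingUnits ι} {ε : Γ →+ Additive Gal(K/F)}

/-- The coefficient `r_γ` of the series `∑ a_γ r_γ`. -/
def coeff (x : MalcevNeumann d ε) (γ : Γ) : fieldCentralizer ι := x.series.coeff γ

theorem ext_coeff {x y : MalcevNeumann d ε} (h : ∀ γ, x.coeff γ = y.coeff γ) : x = y :=
  MalcevNeumann.ext (HahnSeries.ext (funext h))

instance : Zero (MalcevNeumann d ε) := ⟨⟨0⟩⟩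
/-- The unit is `a_0 · 1`. -/
noncomputable instance : One (MalcevNeumann d ε) := ⟨⟨HahnSeries.single 0 1⟩⟩
instance : Add (MalcevNeumann d ε) := ⟨fun x y => ⟨x.series + y.series⟩⟩
instance : Neg (MalcevNeumann d ε) := ⟨fun x => ⟨-x.series⟩⟩

@[simp] theorem coeff_zero (γ : Γ) : (0 : MalcevNeumann d ε).coeff γ = 0 := rfl
@[simp] theorem coeff_add (x y : MalcevNeumann d ε) (γ : Γ) :
    (x + y).coeff γ = x.coeff γ + y.coeff γ := rfl
@[simp] theorem coeff_neg (x : MalcevNeumann d ε) (γ : Γ) : (-x).coeff γ = -x.coeff γ := rfl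
theorem coeff_one (γ : Γ) : (1 : MalcevNeumann d ε).coeff γ = if γ = 0 then 1 else 0 := by
  change (HahnSeries.single (0 : Γ) (1 : fieldCentralizer ι)).coeff γ = _
  split_ifs with h
  · subst h; exact HahnSeries.coeff_single_same _ _
  · exact HahnSeries.coeff_single_of_ne h

/-- The valuation `v (∑ a_γ r_γ) = min {γ | r_γ ≠ 0}`, with `v 0 = ∞`. -/
noncomputable def v (x : MalcevNeumann d ε) : WithTop Γ := x.series.orderTop

theorem zero_le_v_iff {x : MalcevNeumann d ε} : 0 ≤ x.v ↔ ∀ γ < 0, x.coeff γ = 0 := by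
  constructor
  · intro h γ hγ
    exact HahnSeries.coeff_eq_zero_of_lt_orderTop (lt_of_lt_of_le (by exact_mod_cast hγ) h)
  · intro h
    by_contra hlt
    rw [not_le] at hlt
    obtain ⟨g, hg⟩ := WithTop.ne_top_iff_exists.1 hlt.ne_top
    have hg' : x.series.orderTop = g := hg.symm
    refine HahnSeries.coeff_orderTop_ne hg' (h g ?_)
    rw [← hg] at hlt
    exact_mod_cast hlt

theorem zero_lt_v_iff {x : MalcevNeumann d ε} : 0 < x.v ↔ ∀ γ ≤ 0, x.coeff γ = 0 := by
  constructor
  · intro h γ hγ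
    exact HahnSeries.coeff_eq_zero_of_lt_orderTop
      (lt_of_le_of_lt (b := (0 : WithTop Γ)) (by exact_mod_cast hγ) h)
  · intro h
    by_contra hlt
    rw [not_lt] at hlt
    obtain ⟨g, hg⟩ := WithTop.ne_top_iff_exists.1 (ne_top_of_le_ne_top WithTop.zero_ne_top hlt)
    have hg' : x.series.orderTop = g := hg.symm
    refine HahnSeries.coeff_orderTop_ne hg' (h g ?_)
    rw [← hg] at hlt
    exact_mod_cast hlt

/-- The additive embedding `∑ a_γ r_γ ↦ ∑ t^γ u_{ε(γ)} r_γ` into the Hahn series over `A` in a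
central variable `t`; it serves to verify the ring axioms. -/
def toHahnSeries (x : MalcevNeumann d ε) : HahnSeries Γ A where
  coeff γ := (d.u (ε γ).toMul : A) * (x.coeff γ : A)
  isPWO_support' := x.series.isPWO_support.mono fun γ hγ h0 => hγ (by
    have : x.coeff γ = 0 := h0
    simp [this])

@[simp] theorem coeff_toHahnSeries (x : MalcevNeumann d ε) (γ : Γ) :
    x.toHahnSeries.coeff γ = (d.u (ε γ).toMul : A) * (x.coeff γ : A) := rfl

theorem toHahnSeries_injective :
    Function.Injective (toHahnSeries : MalcevNeumann d ε → HahnSeries Γ A) := by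
  intro x y h
  refine ext_coeff fun γ => Subtype.ext ?_
  have := congrArg (fun s => s.coeff γ) h
  simpa using this

theorem support_toHahnSeries (x : MalcevNeumann d ε) :
    x.toHahnSeries.support = x.series.support := by
  ext γ
  change (d.u (ε γ).toMul : A) * (x.coeff γ : A) ≠ 0 ↔ x.coeff γ ≠ 0
  simp

variable [IsMulCommutative Gal(K/F)]

/-- The multiplication: since `r a_δ = a_δ (u_{ε(δ)}⁻¹ r u_{ε(δ)})` and
`a_γ a_δ = a_{γ+δ} u_{ε(γ)ε(δ)}⁻¹ u_{ε(γ)} u_{ε(δ)}`, one has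
`(a_γ r) (a_δ s) = a_{γ+δ} (u_{ε(γ)ε(δ)}⁻¹ u_{ε(γ)} u_{ε(δ)}) (u_{ε(δ)}⁻¹ r u_{ε(δ)}) s`. -/
noncomputable instance : Mul (MalcevNeumann d ε) where
  mul x y :=
    { series :=
        { coeff := fun γ =>
            ∑ ij ∈ Finset.antidiagonal x.series.isPWO_support y.series.isPWO_support γ,
              d.cocycle (ε ij.1).toMul (ε ij.2).toMul *
                d.conj (ε ij.2).toMul (x.coeff ij.1) * y.coeff ij.2
          isPWO_support' :=
            (x.series.isPWO_support.add y.series.isPWO_support).mono fun γ hγ => by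
              obtain ⟨ij, hij, -⟩ := Finset.exists_ne_zero_of_sum_ne_zero hγ
              rw [Finset.mem_antidiagonal] at hij
              exact ⟨ij.1, hij.1, ij.2, hij.2.1, hij.2.2⟩ } }

theorem coeff_mul (x y : MalcevNeumann d ε) (γ : Γ) :
    (x * y).coeff γ =
      ∑ ij ∈ Finset.antidiagonal x.series.isPWO_support y.series.isPWO_support γ,
        d.cocycle (ε ij.1).toMul (ε ij.2).toMul *
          d.conj (ε ij.2).toMul (x.coeff ij.1) * y.coeff ij.2 := rfl

theorem toHahnSeries_zero : (0 : MalcevNeumann d ε).toHahnSeries = 0 := by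
  ext γ; simp

theorem toHahnSeries_add (x y : MalcevNeumann d ε) :
    (x + y).toHahnSeries = x.toHahnSeries + y.toHahnSeries := by
  ext γ; simp [mul_add]

theorem toHahnSeries_neg (x : MalcevNeumann d ε) :
    (-x).toHahnSeries = -x.toHahnSeries := by
  ext γ; simp

theorem toHahnSeries_one : (1 : MalcevNeumann d ε).toHahnSeries = 1 := by
  ext γ
  rw [coeff_toHahnSeries, coeff_one, HahnSeries.coeff_one]
  split_ifs with h
  · subst h; simp [d.u_one]
  · simp

theorem toHahnSeries_mul (x y : MalcevNeumann d ε) :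
    (x * y).toHahnSeries = x.toHahnSeries * y.toHahnSeries := by
  ext γ
  rw [HahnSeries.coeff_mul, coeff_toHahnSeries, coeff_mul]
  push_cast
  rw [Finset.mul_sum]
  refine Finset.sum_congr ?_ ?_
  · ext ij
    simp [support_toHahnSeries]
  · intro ij hij
    rw [Finset.mem_antidiagonal] at hij
    have h : (ε γ).toMul = (ε ij.1).toMul * (ε ij.2).toMul := by
      rw [← hij.2.2, map_add]; rfl
    rw [h, coeff_toHahnSeries, coeff_toHahnSeries]
    simp only [ConjugatingUnits.cocycle, ConjugatingUnits.conj, mul_assoc,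
      Units.mul_inv_cancel_left]

noncomputable instance : Ring (MalcevNeumann d ε) where
  add_assoc x y z := toHahnSeries_injective (by simp only [toHahnSeries_add, add_assoc])
  zero_add x := toHahnSeries_injective (by simp only [toHahnSeries_add, toHahnSeries_zero, zero_add])
  add_zero x := toHahnSeries_injective (by simp only [toHahnSeries_add, toHahnSeries_zero, add_zero])
  add_comm x y := toHahnSeries_injective (by simp only [toHahnSeries_add, add_comm])
  neg_add_cancel x := toHahnSeries_injective (by
    simp only [toHahnSeries_add, toHahnSeries_neg, toHahnSeries_zero, neg_add_cancel])
  left_distrib x y z := toHahnSeries_injective (by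
    simp only [toHahnSeries_add, toHahnSeries_mul, mul_add])
  right_distrib x y z := toHahnSeries_injective (by
    simp only [toHahnSeries_add, toHahnSeries_mul, add_mul])
  zero_mul x := toHahnSeries_injective (by
    simp only [toHahnSeries_zero, toHahnSeries_mul, zero_mul])
  mul_zero x := toHahnSeries_injective (by
    simp only [toHahnSeries_zero, toHahnSeries_mul, mul_zero])
  mul_assoc x y z := toHahnSeries_injective (by simp only [toHahnSeries_mul, mul_assoc])
  one_mul x := toHahnSeries_injective (by simp only [toHahnSeries_one, toHahnSeries_mul, one_mul])
  mul_one x := toHahnSeries_injective (by simp only [toHahnSeries_one, toHahnSeries_mul, mul_one])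
  nsmul := nsmulRec
  zsmul := zsmulRec

/-! ### The subring `F((ker ε))` -/

variable (d ε) in
/-- `F((ker ε))`: the series `∑ a_γ r_γ` with `r_γ ∈ F` for all `γ`, and `r_γ = 0` for all `γ`
outside `ker ε`. -/
def laurentBase : Subring (MalcevNeumann d ε) where
  carrier := {x | ∀ γ, x.coeff γ ∈ baseInCentralizer ι ∧ (γ ∉ ε.ker → x.coeff γ = 0)}
  zero_mem' γ := ⟨zero_mem _, fun _ => rfl⟩
  one_mem' γ := by
    rw [coeff_one]
    split_ifs with h
    · subst h; exact ⟨one_mem _, fun h => (h (zero_mem _)).elim⟩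
    · exact ⟨zero_mem _, fun _ => rfl⟩
  add_mem' {x y} hx hy γ := ⟨add_mem (hx γ).1 (hy γ).1, fun h => by
    rw [coeff_add, (hx γ).2 h, (hy γ).2 h, add_zero]⟩
  neg_mem' {x} hx γ := ⟨neg_mem (hx γ).1, fun h => by rw [coeff_neg, (hx γ).2 h, neg_zero]⟩
  mul_mem' {x y} hx hy γ := by
    have key : ∀ i j : Γ, x.coeff i ≠ 0 → y.coeff j ≠ 0 →
        (i ∈ ε.ker ∧ j ∈ ε.ker) ∧
        d.cocycle (ε i).toMul (ε j).toMul * d.conj (ε j).toMul (x.coeff i) * y.coeff j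
          = x.coeff i * y.coeff j := by
      intro i j hi hj
      have hi' : i ∈ ε.ker := by by_contra h; exact hi ((hx i).2 h)
      have hj' : j ∈ ε.ker := by by_contra h; exact hj ((hy j).2 h)
      refine ⟨⟨hi', hj'⟩, ?_⟩
      rw [AddMonoidHom.mem_ker] at hi' hj'
      rw [hi', hj']
      apply Subtype.ext
      simp [ConjugatingUnits.cocycle, ConjugatingUnits.conj, d.u_one]
    constructor
    · rw [coeff_mul]
      refine sum_mem fun ij hij => ?_
      rw [Finset.mem_antidiagonal] at hij
      rw [(key ij.1 ij.2 hij.1 hij.2.1).2]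
      exact mul_mem (hx _).1 (hy _).1
    · intro h
      rw [coeff_mul]
      refine Finset.sum_eq_zero fun ij hij => (h ?_).elim
      rw [Finset.mem_antidiagonal] at hij
      have := (key ij.1 ij.2 hij.1 hij.2.1).1
      rw [← hij.2.2]
      exact add_mem this.1 this.2

/-! ### The valuation ring and residue fields -/

variable (d ε) in
/-- The valuation ring `{x | v x ≥ 0}`. -/
noncomputable def valuationRing : Subring (MalcevNeumann d ε) where
  carrier := {x | 0 ≤ x.v}
  zero_mem' := zero_le_v_iff.2 fun _ _ => rfl
  one_mem' := zero_le_v_iff.2 fun γ hγ => by rw [coeff_one, if_neg hγ.ne]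
  add_mem' {x y} hx hy := zero_le_v_iff.2 fun γ hγ => by
    rw [coeff_add, zero_le_v_iff.1 hx γ hγ, zero_le_v_iff.1 hy γ hγ, add_zero]
  neg_mem' {x} hx := zero_le_v_iff.2 fun γ hγ => by
    rw [coeff_neg, zero_le_v_iff.1 hx γ hγ, neg_zero]
  mul_mem' {x y} hx hy := zero_le_v_iff.2 fun γ hγ => by
    rw [coeff_mul]
    refine Finset.sum_eq_zero fun ij hij => ?_
    rw [Finset.mem_antidiagonal] at hij
    have h1 : 0 ≤ ij.1 := by
      by_contra h; exact hij.1 (zero_le_v_iff.1 hx _ (not_le.1 h))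
    have h2 : 0 ≤ ij.2 := by
      by_contra h; exact hij.2.1 (zero_le_v_iff.1 hy _ (not_le.1 h))
    exact absurd (add_nonneg h1 h2) (by rw [hij.2.2]; exact not_le.2 hγ)

theorem coeff_zero_mul {x y : MalcevNeumann d ε} (hx : 0 ≤ x.v) (hy : 0 ≤ y.v) :
    (x * y).coeff 0 = x.coeff 0 * y.coeff 0 := by
  have hz : d.cocycle (ε (0 : Γ)).toMul (ε (0 : Γ)).toMul *
      d.conj (ε (0 : Γ)).toMul (x.coeff 0) * y.coeff 0 = x.coeff 0 * y.coeff 0 := by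
    apply Subtype.ext
    simp [ConjugatingUnits.cocycle, ConjugatingUnits.conj, d.u_one]
  rw [coeff_mul, ← hz]
  have huniq : ∀ ij ∈ Finset.antidiagonal x.series.isPWO_support y.series.isPWO_support 0,
      ij = ((0, 0) : Γ × Γ) := by
    intro ij hij
    rw [Finset.mem_antidiagonal] at hij
    have h1 : 0 ≤ ij.1 := by
      by_contra h; exact hij.1 (zero_le_v_iff.1 hx _ (not_le.1 h))
    have h2 : 0 ≤ ij.2 := by
      by_contra h; exact hij.2.1 (zero_le_v_iff.1 hy _ (not_le.1 h))
    have h3 := (add_eq_zero_iff_of_nonneg h1 h2).1 hij.2.2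
    exact Prod.ext h3.1 h3.2
  refine Finset.sum_eq_single (0, 0) (fun ij hij hne => (hne (huniq ij hij)).elim) fun hnot => ?_
  rw [Finset.mem_antidiagonal] at hnot
  rw [hz]
  by_cases hx0 : x.coeff 0 = 0
  · rw [hx0, zero_mul]
  by_cases hy0 : y.coeff 0 = 0
  · rw [hy0, mul_zero]
  exact (hnot ⟨hx0, hy0, add_zero 0⟩).elim

variable (d ε) in
/-- The residue map `∑ a_γ r_γ ↦ r_0` from the valuation ring to `C_A(K)`. It is surjective with
kernel `{x | v x > 0}` (see the two lemmas below), so it identifies `C_A(K)` with the residue ring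
of the valuation `v`. -/
noncomputable def residue : valuationRing d ε →+* fieldCentralizer ι where
  toFun x := (x : MalcevNeumann d ε).coeff 0
  map_zero' := rfl
  map_one' := by
    change (1 : MalcevNeumann d ε).coeff 0 = 1
    rw [coeff_one, if_pos rfl]
  map_add' _ _ := rfl
  map_mul' x y := coeff_zero_mul x.2 y.2

theorem residue_surjective : Function.Surjective (residue d ε) := by
  intro r
  have h : ∀ γ < (0 : Γ), (HahnSeries.single (0 : Γ) r).coeff γ = 0 := fun γ hγ =>
    HahnSeries.coeff_single_of_ne hγ.ne
  exact ⟨⟨⟨HahnSeries.single 0 r⟩, zero_le_v_iff.2 h⟩, HahnSeries.coeff_single_same 0 r⟩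

theorem residue_eq_zero_iff (x : valuationRing d ε) :
    residue d ε x = 0 ↔ 0 < (x : MalcevNeumann d ε).v := by
  rw [zero_lt_v_iff]
  constructor
  · intro h γ hγ
    rcases hγ.lt_or_eq with h1 | rfl
    · exact zero_le_v_iff.1 x.2 γ h1
    · exact h
  · intro h
    exact h 0 le_rfl

/-- The residue field `L̄` of a subfield `L`, as a subring of the residue ring `C_A(K)`: the set of
residues of the elements `x ∈ L` with `v x ≥ 0`. -/
noncomputable def residueField (L : Subring (MalcevNeumann d ε)) :
    Subring (fieldCentralizer ι) :=
  (L.comap (valuationRing d ε).subtype).map (residue d ε)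

theorem mem_residueField {L : Subring (MalcevNeumann d ε)} {r : fieldCentralizer ι} :
    r ∈ residueField L ↔ ∃ x ∈ L, 0 ≤ x.v ∧ x.coeff 0 = r := by
  constructor
  · rintro ⟨x, hx, rfl⟩
    exact ⟨x, hx, x.2, rfl⟩
  · rintro ⟨x, hx, hv, rfl⟩
    exact ⟨⟨x, hv⟩, hx, rfl⟩

/-- The degree `[L̄ : F]`: the dimension over `F` of the `F`-subspace of `C_A(K)` spanned by `L̄`.
When `F((ker ε)) ⊆ L`, that subspace is `L̄` itself (see the lemma below). -/
noncomputable def residueDegree (L : Subring (MalcevNeumann d ε)) : ℕ :=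
  Module.finrank F (Submodule.span F (residueField L : Set (fieldCentralizer ι)))

theorem coe_span_residueField {L : Subring (MalcevNeumann d ε)} (hL : laurentBase d ε ≤ L) :
    (Submodule.span F (residueField L : Set (fieldCentralizer ι)) : Set (fieldCentralizer ι)) =
      residueField L := by
  refine Set.Subset.antisymm (fun r hr => ?_) Submodule.subset_span
  have hF : ∀ c : F, algebraMap F (fieldCentralizer ι) c ∈ residueField L := by
    intro c
    have hco : ∀ γ : Γ, (⟨HahnSeries.single 0 (algebraMap F _ c)⟩ : MalcevNeumann d ε).coeff γ
        = if γ = 0 then algebraMap F _ c else 0 := by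
      intro γ
      change (HahnSeries.single (0 : Γ) (algebraMap F (fieldCentralizer ι) c)).coeff γ = _
      split_ifs with h
      · subst h; exact HahnSeries.coeff_single_same _ _
      · exact HahnSeries.coeff_single_of_ne h
    refine mem_residueField.2 ⟨⟨HahnSeries.single 0 (algebraMap F _ c)⟩, hL fun γ => ?_,
      zero_le_v_iff.2 fun γ hγ => ?_, ?_⟩
    · rw [hco]
      split_ifs with h
      · subst h; exact ⟨⟨c, rfl⟩, fun h => (h (zero_mem _)).elim⟩
      · exact ⟨zero_mem _, fun _ => rfl⟩
    · rw [hco, if_neg hγ.ne]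
    · rw [hco, if_pos rfl]
  induction hr using Submodule.span_induction with
  | mem x h => exact h
  | zero => exact zero_mem _
  | add x y _ _ hx hy => exact add_mem hx hy
  | smul c x _ hx =>
    rw [Algebra.smul_def]
    exact mul_mem (hF c) hx

end MalcevNeumann

end Construction

/-! Write `C` for `C_A(K)`, `Z` for `F((ker ε))`, `D` for the Malcev-Neumann ring and `M₀` for the
compositum of the residue field `L̄` with `K`. Maximality of `M₀` is a dimension count. Let `V ⊆ G`
be the set of classes in `Γ / ker ε ≅ G` of values of elements of `L`, and let `M ⊇ M₀` be a
subfield of `C`. Then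

`[M : F]² ≤ |G| [C : F] ≤ [D : Z] ≤ [L : Z]² ≤ (|V| [L̄ : F])² ≤ [M₀ : F]²`,

so `M = M₀`. The first inequality holds because `C` is a division algebra with centre `K` and `|G| =
[K : F]`. The second exhibits independent monomials. The third holds because `D` is a division
algebra in which `L` is its own centralizer. For the fourth, leading coefficients of `L` in a fixed
degree form an `F`-space of dimension at most `[L̄ : F]`. For the fifth, an element of `L` with
leading term `a_γ r`, `ε γ = σ`, commutes with `L`; comparing leading terms shows that conjugation
by `u_σ r` fixes `L̄` pointwise and acts on `K` as `σ`. So `V` yields `|V|` distinct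
`L̄`-endomorphisms of `M₀`.

For the Galois statement, take `x ∈ L` with `v x ≥ 0`. Its minimal polynomial over `Z` splits in
`L`, and its roots are conjugate to `x` in `D`, hence also have value `≥ 0`. The polynomial
therefore reduces to one over `F` that splits in `L̄` and kills the residue of `x`. So `L̄ / F` is
normal, it is separable by the condition on the degree, and the compositum with the Galois extension
`K / F` is Galois.

Both dimension bounds in division algebras and the conjugacy of roots rest on one shortest-relation
argument, `IsDivisionAlgebra.exists_centralizing_relation`. The structure of `A` over `C` is
obtained by averaging over `G` with trace-dual bases. -/

/-! ### Division algebras and their subfields -/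

section DivisionAlgebras

/-- The division ring structure on a ring satisfying `IsDivisionAlgebra`. -/
noncomputable abbrev IsDivisionAlgebra.divisionRing {E : Type*} [Ring E]
    (hE : IsDivisionAlgebra E) : DivisionRing E :=
  haveI := hE.1
  DivisionRing.ofIsUnitOrEqZero fun a => (em (a = 0)).symm.imp (hE.2 a) id

/-- If `b ↦ ∑ cᵢ b dᵢ` vanishes on a subring `S` of a division ring and not all `cᵢ` are zero,
then the `dᵢ` are left dependent over the centralizer of `S`. -/
theorem IsDivisionAlgebra.exists_centralizing_relation {E : Type*} [Ring E]
    (hE : IsDivisionAlgebra E) (S : Subring E) {n : Type*} [Fintype n] (c d : n → E)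
    (hc : c ≠ 0) (h : ∀ b ∈ S, ∑ i, c i * b * d i = 0) :
    ∃ e : n → E, e ≠ 0 ∧ (∀ i, ∀ b ∈ S, b * e i = e i * b) ∧ ∑ i, e i * d i = 0 := by
  classical
  -- Induction on the number of nonzero `cᵢ`, after scaling on the left so that the coefficient at
  -- `i₀` is `1`.
  induction hk : (Finset.univ.filter (c · ≠ 0)).card using Nat.strong_induction_on
    generalizing c with
  | _ k ih =>
  obtain ⟨i₀, hi₀⟩ := Function.ne_iff.1 hc
  obtain ⟨w, hw⟩ := (hE.2 _ hi₀).exists_left_inv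
  have hsum : ∀ b ∈ S, ∑ i, w * c i * b * d i = 0 := fun b hb => by
    simpa [Finset.mul_sum, mul_assoc] using congrArg (w * ·) (h b hb)
  by_cases hcomm : ∀ i, ∀ b ∈ S, b * (w * c i) = w * c i * b
  · refine ⟨fun i => w * c i, fun h0 => ?_, hcomm, ?_⟩
    · have h1 := congrFun h0 i₀
      have := hE.1
      exact one_ne_zero (hw.symm.trans h1)
    · simpa using hsum 1 S.one_mem
  · push Not at hcomm
    obtain ⟨i₁, b', hb', hne⟩ := hcomm
    -- Commutators with `b'` again give a vanishing relation. It is shorter, since the entry at `i₀`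
    -- is `1` and commutes with `b'`, and it is nonzero at `i₁`.
    refine ih _ ?_ (fun i => w * c i * b' - b' * (w * c i)) ?_ ?_ rfl
    · rw [← hk]
      refine Finset.card_lt_card (Finset.ssubset_iff_of_subset ?_ |>.2 ⟨i₀, ?_, ?_⟩)
      · intro i hi
        simp only [Finset.mem_filter, Finset.mem_univ, true_and] at hi ⊢
        rintro h0
        simp [h0] at hi
      · simpa using hi₀
      · simp [hw]
    · exact fun h0 => hne (sub_eq_zero.1 (congrFun h0 i₁)).symm
    · intro b hb
      have h1 := hsum (b' * b) (S.mul_mem hb' hb)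
      have h2 := congrArg (b' * ·) (hsum b hb)
      simp only [Finset.mul_sum, mul_zero] at h2
      rw [← sub_eq_zero.2 (h1.trans h2.symm), ← Finset.sum_sub_distrib]
      refine Finset.sum_congr rfl fun i _ => ?_
      simp only [sub_mul, mul_assoc]

/-- More rows than columns: the rows are left dependent. -/
theorem IsDivisionAlgebra.exists_row_relation {E : Type*} [Ring E]
    (hE : IsDivisionAlgebra E) {m n : Type*} [Fintype m] [Fintype n]
    (h : Fintype.card n < Fintype.card m) (w : m → n → E) :
    ∃ c : m → E, c ≠ 0 ∧ ∀ j, ∑ i, c i * w i j = 0 := by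
  let := hE.divisionRing
  have hdep : ¬ LinearIndependent E w := fun hw => by
    have := hw.fintype_card_le_finrank
    rw [Module.finrank_fintype_fun_eq_card] at this
    omega
  rw [Fintype.linearIndependent_iff] at hdep
  push Not at hdep
  obtain ⟨c, hc, i, hi⟩ := hdep
  refine ⟨c, fun h0 => hi (congrFun h0 i), fun j => ?_⟩
  simpa using congrFun hc j

/-- A self-centralizing subfield `L` of a division algebra satisfies `[D : Z] ≤ [L : Z]²`. -/
theorem IsDivisionAlgebra.finrank_le_sq {Z D : Type*} [Field Z] [Ring D]
    [Algebra Z D] [FiniteDimensional Z D] (hD : IsDivisionAlgebra D) (L : Subalgebra Z D)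
    (hL : IsField L) (hself : ∀ c, (∀ x ∈ L, x * c = c * x) → c ∈ L) :
    Module.finrank Z D ≤ Module.finrank Z L ^ 2 := by
  let : Field L := hL.toField
  have : IsScalarTower Z L D := inferInstance
  have : FiniteDimensional L D := Module.Finite.of_restrictScalars_finite Z L D
  rw [← Module.finrank_mul_finrank Z L D, sq]
  refine Nat.mul_le_mul_left _ ?_
  by_contra! hlt
  let x := Module.finBasis L D
  let b := Module.finBasis Z L
  -- If `[D : L] > [L : Z]`, one relation holds for all `b j` at once, hence by `Z`-linearity for
  -- every `y ∈ L` between `c i` and `x i`. Its centralizing version has coefficients in `L` and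
  -- contradicts the independence of `x`.
  obtain ⟨c, hc, hrel⟩ := hD.exists_row_relation (by simpa using hlt)
    (fun i j => (b j : D) * x i)
  have hvan : ∀ y ∈ L.toSubring, ∑ i, c i * y * x i = 0 := by
    intro y hy
    have hy' : y = ∑ j, b.repr ⟨y, hy⟩ j • (b j : D) := by
      have := congrArg L.val (b.sum_repr ⟨y, hy⟩)
      rw [map_sum] at this
      exact this.symm
    rw [hy']
    simp only [Finset.mul_sum, Finset.sum_mul]
    rw [Finset.sum_comm]
    refine Finset.sum_eq_zero fun j _ => ?_
    have := congrArg (b.repr ⟨y, hy⟩ j • ·) (hrel j)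
    simpa [Finset.smul_sum, mul_assoc] using this
  obtain ⟨e, he, hcomm, hsum⟩ := hD.exists_centralizing_relation L.toSubring c x hc hvan
  have hmem : ∀ i, e i ∈ L := fun i => hself _ (hcomm i)
  have := Fintype.linearIndependent_iff.1 x.linearIndependent (fun i => ⟨e i, hmem i⟩)
    (by simpa [Subalgebra.smul_def] using hsum)
  exact he (funext fun i => congrArg Subtype.val (this i))

/-- A field `M` in a division algebra `E` with centre `K` satisfies `[M : K]² ≤ [E : K]`. -/
theorem IsDivisionAlgebra.sq_finrank_le {K M E : Type*} [Field K] [Ring E] [Field M]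
    [Algebra K E] [FiniteDimensional K E] (hE : IsDivisionAlgebra E)
    (hcenter : ∀ c : E, (∀ x, x * c = c * x) → c ∈ Set.range (algebraMap K E))
    [Algebra K M] (f : M →ₐ[K] E) :
    Module.finrank K M ^ 2 ≤ Module.finrank K E := by
  -- `M` acts by right multiplication, so that the left coefficients `c i` pass through expansions
  -- in an `M`-basis of `E`.
  let : Module M E := Module.compHom E
    ((f : M →+* E).toOpposite fun x y => by
      change f x * f y = f y * f x
      rw [← map_mul, mul_comm, map_mul])
  have hsmul : ∀ (m : M) (x : E), m • x = x * f m := fun _ _ => rfl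
  have : IsScalarTower K M E := ⟨fun k m x => by simp [hsmul]⟩
  have : FiniteDimensional M E := Module.Finite.of_restrictScalars_finite K M E
  have := hE.1
  have : FiniteDimensional K M := FiniteDimensional.of_injective f.toLinearMap f.injective
  rw [← Module.finrank_mul_finrank K M E, sq]
  refine Nat.mul_le_mul_left _ ?_
  by_contra! hlt
  let x := Module.finBasis M E
  let b := Module.finBasis K M
  obtain ⟨c, hc, hrel⟩ := hE.exists_row_relation (by simpa using hlt)
    (fun i j => x j * f (b i))
  have hvan : ∀ y ∈ (⊤ : Subring E), ∑ i, c i * y * f (b i) = 0 := by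
    intro y _
    rw [← x.sum_repr y]
    simp only [Finset.mul_sum, Finset.sum_mul]
    rw [Finset.sum_comm]
    refine Finset.sum_eq_zero fun j _ => ?_
    have := congrArg (· * f (x.repr y j)) (hrel j)
    simp only [Finset.sum_mul, zero_mul] at this
    rw [← this]
    refine Finset.sum_congr rfl fun i _ => ?_
    rw [hsmul]
    simp only [mul_assoc]
    rw [← map_mul, ← map_mul, mul_comm]
  obtain ⟨e, he, hcomm, hsum⟩ :=
    hE.exists_centralizing_relation ⊤ c (fun i => f (b i)) hc hvan
  choose k hk using fun i => hcenter (e i) fun y => hcomm i y trivial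
  have := Fintype.linearIndependent_iff.1 b.linearIndependent k (f.injective (by
    simpa [← hk, Algebra.smul_def] using hsum))
  exact he (funext fun i => by rw [← hk, this, map_zero]; rfl)

theorem Subring.isField_of_isUnit {D : Type*} [Ring D] [Nontrivial D] (S : Subring D)
    (hcomm : ∀ x ∈ S, ∀ y ∈ S, x * y = y * x)
    (hinv : ∀ x ∈ S, x ≠ 0 → ∃ y ∈ S, x * y = 1) : IsField S where
  exists_pair_ne := ⟨0, 1, zero_ne_one⟩
  mul_comm x y := Subtype.ext (hcomm _ x.2 _ y.2)
  mul_inv_cancel {a} ha := by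
    obtain ⟨y, hy, h⟩ := hinv a a.2 (by simpa using ha)
    exact ⟨⟨y, hy⟩, Subtype.ext h⟩

/-- A maximal subfield of a division algebra is its own centralizer. -/
theorem IsMaximalSubfield.mem_of_commute {D : Type*} [Ring D] (hD : IsDivisionAlgebra D)
    {L : Subring D} (hL : IsMaximalSubfield L) {c : D} (hc : ∀ x ∈ L, x * c = c * x) :
    c ∈ L := by
  have := hD.1
  let X : Set D := insert c L
  -- The double centralizer of a commuting set is commutative and closed under inverses, so
  -- adjoining `c` to `L` stays inside a field.
  let S : Subring D := Subring.centralizer (Subring.centralizer X : Set D)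
  have hXcomm : ∀ x ∈ X, ∀ y ∈ X, x * y = y * x := by
    have hLL : ∀ x ∈ L, ∀ y ∈ L, x * y = y * x := fun x hx y hy =>
      congrArg Subtype.val (hL.prop.mul_comm ⟨x, hx⟩ ⟨y, hy⟩)
    rintro x (rfl | hx) y (rfl | hy)
    · rfl
    · exact (hc y hy).symm
    · exact hc x hx
    · exact hLL x hx y hy
  have hXS : X ⊆ S := fun x hx => Subring.mem_centralizer_iff.2 fun y hy =>
    (Subring.mem_centralizer_iff.1 hy x hx).symm
  have hXC : X ⊆ Subring.centralizer X := fun x hx => Subring.mem_centralizer_iff.2 fun y hy =>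
    hXcomm y hy x hx
  have hS : IsField S := by
    refine S.isField_of_isUnit (fun x hx y hy => ?_) (fun x hx hx0 => ?_)
    · refine Subring.mem_centralizer_iff.1 hy x (Subring.mem_centralizer_iff.2 fun z hz => ?_)
      exact Subring.mem_centralizer_iff.1 hx z (hXC hz)
    · obtain ⟨u, rfl⟩ := hD.2 x hx0
      refine ⟨(↑u⁻¹ : D), Subring.mem_centralizer_iff.2 fun z hz => ?_, u.mul_inv⟩
      exact (Units.mul_inv_eq_iff_eq_mul u).2 (by
        rw [mul_assoc, Subring.mem_centralizer_iff.1 hx z hz, Units.inv_mul_cancel_left])|>.symm ▸ rfl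
  exact hL.le_of_ge hS (fun x hx => hXS (Or.inr hx)) (hXS (Or.inl rfl))

end DivisionAlgebras

/-! ### Trace-dual bases and the structure of `A` over `C_A(K)` -/

section Centralizer

variable {F K A : Type*} [Field F] [Field K] [Algebra F K] [Ring A] [Algebra F A]

/-- Dual bases with respect to the trace form, and their orthogonality relations. -/
theorem IsGalois.exists_trace_dual_bases (F K : Type*) [Field F] [Field K] [Algebra F K]
    [FiniteDimensional F K] [IsGalois F K] :
    ∃ (n : ℕ) (x y : Fin n → K), ∑ i, x i * y i = 1 ∧
      (∀ τ : Gal(K/F), τ ≠ 1 → ∑ i, x i * τ (y i) = 0) ∧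
      ∀ z : K, ∃ c : Fin n → Fin n → F, (∀ i, z * x i = ∑ j, c i j • x j) ∧
        ∀ j, z * y j = ∑ i, c i j • y i := by
  classical
  let x := Module.finBasis F K
  let B := Algebra.traceForm F K
  have hB : B.Nondegenerate := traceForm_nondegenerate F K
  let y := B.dualBasis hB x
  have hyx : ∀ i j, Algebra.trace F K (x i * y j) = if i = j then 1 else 0 := by
    intro i j
    have := LinearMap.BilinForm.apply_dualBasis_left hB x j i
    rwa [Algebra.traceForm_apply, mul_comm] at this
  have horth : ∀ τ : Gal(K/F), ∑ i, x i * τ (y i) = if τ = 1 then 1 else 0 := by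
    let P : Matrix (Fin (Module.finrank F K)) Gal(K/F) K := fun i σ => σ (x i)
    let Q : Matrix Gal(K/F) (Fin (Module.finrank F K)) K := fun σ i => σ (y i)
    have hPQ : P * Q = 1 := by
      ext i j
      rw [Matrix.mul_apply, Matrix.one_apply]
      have := congrArg (algebraMap F K) (hyx i j)
      rw [trace_eq_sum_automorphisms] at this
      simpa [P, Q, apply_ite (algebraMap F K)] using this
    have hcard : Fintype.card (Fin (Module.finrank F K)) = Fintype.card Gal(K/F) := by
      rw [Fintype.card_fin, ← IsGalois.card_aut_eq_finrank F K, Nat.card_eq_fintype_card]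
    -- Trace duality says `P * Q = 1`. Both index sets have `[K : F]` elements, so `Q * P = 1`,
    -- which is the orthogonality of the conjugates.
    have hQP := (Matrix.mul_eq_one_comm_of_card_eq _ _ _ hcard).1 hPQ
    intro τ
    have := congrFun (congrFun hQP τ) 1
    rw [Matrix.mul_apply, Matrix.one_apply] at this
    rw [← this]
    exact Finset.sum_congr rfl fun i _ => mul_comm _ _
  refine ⟨_, x, y, by simpa using horth 1, fun τ h => by rw [horth, if_neg h], fun z =>
    ⟨fun i j => Algebra.trace F K (z * x i * y j), ?_, ?_⟩⟩
  · intro i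
    have hrep : ∀ w, x.repr w = fun j => Algebra.trace F K (w * y j) := by
      intro w
      funext j
      conv_rhs => rw [← x.sum_repr w]
      simp only [Finset.sum_mul, map_sum, smul_mul_assoc, map_smul, hyx]
      simp
    conv_lhs => rw [← x.sum_repr (z * x i), hrep]
  · intro j
    have hrep : ∀ w, y.repr w = fun i => Algebra.trace F K (w * x i) := by
      intro w
      funext i
      conv_rhs => rw [← y.sum_repr w]
      simp only [Finset.sum_mul, map_sum, smul_mul_assoc, map_smul, mul_comm (y _) (x _), hyx]
      simp
    conv_lhs => rw [← y.sum_repr (z * y j), hrep]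
    exact Finset.sum_congr rfl fun i _ => by beta_reduce; rw [mul_right_comm]

namespace ConjugatingUnits

variable {ι : K →ₐ[F] A} (d : ConjugatingUnits ι)

theorem u_mul_mul_inv_mem (σ : Gal(K/F)) {r : A} (hr : r ∈ fieldCentralizer ι) :
    (d.u σ : A) * r * (↑(d.u σ)⁻¹ : A) ∈ fieldCentralizer ι := by
  rw [mem_iff] at hr ⊢
  intro x
  calc ι x * ((d.u σ : A) * r * (↑(d.u σ)⁻¹ : A))
      = ι x * (d.u σ : A) * r * (↑(d.u σ)⁻¹ : A) := by simp only [mul_assoc]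
    _ = (d.u σ : A) * (r * ι (σ x)) * (↑(d.u σ)⁻¹ : A) := by
        rw [d.comm_u, ← hr]; simp only [mul_assoc]
    _ = (d.u σ : A) * r * (↑(d.u σ)⁻¹ : A) * ι x := by
        rw [mul_assoc _ _ (ι x), d.comm_u_inv]; simp only [mul_assoc]

variable [FiniteDimensional F K] [IsGalois F K]

/-- `A = ∑ u_σ C_A(K)`. -/
theorem exists_eq_sum (a : A) :
    ∃ r : Gal(K/F) → fieldCentralizer ι, a = ∑ σ, (d.u σ : A) * (r σ : A) := by
  obtain ⟨n, x, y, hxy, hxy', hslide⟩ := IsGalois.exists_trace_dual_bases F K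
  -- The component of `a` in `u_σ C_A(K)`. Since `∑ xᵢ ⊗ yᵢ` is a separability idempotent, a factor
  -- `z` slides from its left to its right leg, where it appears as `σ z`.
  let p : Gal(K/F) → A := fun σ => ∑ i, ι (x i) * a * ι (σ (y i))
  have hp : ∀ σ z, ι z * p σ = p σ * ι (σ z) := by
    intro σ z
    obtain ⟨c, hcx, hcy⟩ := hslide z
    have h1 : ι z * p σ = ∑ i, ∑ j, c i j • (ι (x j) * a * ι (σ (y i))) := by
      simp only [p, Finset.mul_sum]
      refine Finset.sum_congr rfl fun i _ => ?_
      rw [← mul_assoc, ← mul_assoc, ← map_mul, hcx]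
      simp [Finset.sum_mul]
    have h2 : p σ * ι (σ z) = ∑ j, ∑ i, c i j • (ι (x j) * a * ι (σ (y i))) := by
      simp only [p, Finset.sum_mul]
      refine Finset.sum_congr rfl fun j _ => ?_
      rw [mul_assoc, ← map_mul, ← map_mul, mul_comm (y j) z, hcy]
      simp [Finset.mul_sum]
    rw [h1, h2, Finset.sum_comm]
  refine ⟨fun σ => ⟨(↑(d.u σ)⁻¹ : A) * p σ, mem_iff.2 fun z => ?_⟩, ?_⟩
  · obtain ⟨w, rfl⟩ := σ.surjective z
    rw [← mul_assoc, ← d.comm_u_inv, mul_assoc, mul_assoc, hp]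
  · simp only [Units.mul_inv_cancel_left, p]
    -- Summing over `σ` produces the trace of `y i`, a scalar that moves past `a`; the orthogonality
    -- relations then leave only `σ = 1`.
    have htr : ∀ i, ∑ σ : Gal(K/F), ι (x i) * a * ι (σ (y i)) =
        ι (x i * ∑ σ : Gal(K/F), σ (y i)) * a := by
      intro i
      rw [← trace_eq_sum_automorphisms, ← Finset.mul_sum, ← map_sum,
        ← trace_eq_sum_automorphisms, map_mul, AlgHom.commutes, mul_assoc, mul_assoc,
        ← Algebra.commutes]
    rw [Finset.sum_comm]
    simp only [htr]
    rw [← Finset.sum_mul, ← map_sum]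
    simp only [Finset.mul_sum]
    rw [Finset.sum_comm, Finset.sum_eq_single 1 (fun σ _ h => hxy' σ h) (by simp)]
    simp [hxy]

/-- An element commuting with `C_A(K)` and with all `u_σ` is a scalar. -/
theorem mem_range_of_commute [Algebra.IsCentral F A] {r : A}
    (hr : ∀ s ∈ fieldCentralizer ι, s * r = r * s) (hu : ∀ σ, (d.u σ : A) * r = r * d.u σ) :
    r ∈ Set.range (algebraMap F A) := by
  have : r ∈ Subalgebra.center F A := Subalgebra.mem_center_iff.2 fun a => by
    obtain ⟨s, rfl⟩ := d.exists_eq_sum a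
    rw [Finset.sum_mul, Finset.mul_sum]
    refine Finset.sum_congr rfl fun σ _ => ?_
    rw [mul_assoc, hr _ (s σ).2, ← mul_assoc, hu, mul_assoc]
  exact Algebra.mem_bot.1 (Algebra.IsCentral.out this)

/-- The centralizer of `C_A(K)` is `K`. -/
theorem mem_range_of_commute_centralizer (d : ConjugatingUnits ι) [Algebra.IsCentral F A] {r : A}
    (hc : ∀ s ∈ fieldCentralizer ι, s * r = r * s) : r ∈ Set.range ι := by
  obtain ⟨n, x, y, hxy, hxy', -⟩ := IsGalois.exists_trace_dual_bases F K
  -- On the centralizer of `C_A(K)`, conjugation by `u_σ` depends only on `σ`: `u_σ u_τ` and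
  -- `u_{τσ}` differ by a factor in `C_A(K)`. So `tr` averages over an action of the Galois group
  -- and lands in the scalars.
  let tr : A → A := fun a => ∑ σ, (↑(d.u σ)⁻¹ : A) * a * (d.u σ : A)
  have htr : ∀ a, (∀ s ∈ fieldCentralizer ι, s * a = a * s) →
      tr a ∈ Set.range (algebraMap F A) := by
    intro a ha
    refine d.mem_range_of_commute (fun s hs => ?_) (fun τ => ?_)
    · simp only [tr, Finset.mul_sum, Finset.sum_mul]
      refine Finset.sum_congr rfl fun σ _ => ?_
      have h := ha _ (d.u_mul_mul_inv_mem σ hs)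
      have h' := congrArg (fun t => (↑(d.u σ)⁻¹ : A) * t * (d.u σ : A)) h
      simpa [mul_assoc] using h'
    · have key : ∀ σ, (↑(d.u τ)⁻¹ : A) * ((↑(d.u σ)⁻¹ : A) * a * (d.u σ : A)) * (d.u τ : A) =
          (↑(d.u (τ * σ))⁻¹ : A) * a * (d.u (τ * σ) : A) := by
        intro σ
        have hs : (d.u σ : A) * (d.u τ : A) * (↑(d.u (τ * σ))⁻¹ : A) ∈ fieldCentralizer ι := by
          rw [mem_iff]
          intro z
          rw [mul_assoc _ _ (ι z), d.comm_u_inv, ← mul_assoc, ← mul_assoc, d.comm_u, mul_assoc _ _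
            (d.u τ : A), d.comm_u]
          simp [mul_assoc]
        have h := congrArg (fun t => (↑(d.u τ)⁻¹ : A) * (↑(d.u σ)⁻¹ : A) * t * (d.u (τ * σ) : A))
          (ha _ hs)
        simp only [mul_assoc, Units.inv_mul_cancel_left, Units.inv_mul, mul_one] at h ⊢
        exact h.symm
      have h1 : (↑(d.u τ)⁻¹ : A) * tr a * (d.u τ : A) = tr a := by
        simp only [tr, Finset.mul_sum, Finset.sum_mul, key]
        exact Fintype.sum_equiv (Equiv.mulLeft τ) _ _ fun σ => rfl
      have h2 := congrArg ((d.u τ : A) * ·) h1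
      simpa [mul_assoc] using h2.symm
  have hy : ∀ i, ∀ s ∈ fieldCentralizer ι, s * (ι (y i) * r) = ι (y i) * r * s := fun i s hs => by
    rw [← mul_assoc, ← mem_iff.1 hs, mul_assoc, hc s hs, mul_assoc]
  choose f hf using fun i => htr _ (hy i)
  -- Galois descent: expanding `∑ xᵢ tr (yᵢ r)` puts the coefficient `∑ xᵢ σ(yᵢ)` before the
  -- `σ`-conjugate of `r`, and this vanishes unless `σ = 1`.
  refine ⟨∑ i, x i * algebraMap F K (f i), ?_⟩
  simp only [map_sum, map_mul, AlgHom.commutes, hf]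
  have : ∀ i, ι (x i) * tr (ι (y i) * r) =
      ∑ σ, ι (x i * σ (y i)) * ((↑(d.u σ)⁻¹ : A) * r * (d.u σ : A)) := by
    intro i
    simp only [tr, Finset.mul_sum]
    refine Finset.sum_congr rfl fun σ _ => ?_
    rw [map_mul, ← mul_assoc (↑(d.u σ)⁻¹ : A), d.comm_u_inv]
    simp only [mul_assoc]
  simp only [this]
  rw [Finset.sum_comm]
  simp only [← Finset.sum_mul, ← map_sum]
  rw [Finset.sum_eq_single 1]
  · simp [d.u_one, hxy]
  · intro σ _ h
    simp [hxy' σ h]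
  · simp

end ConjugatingUnits

end Centralizer

/-! ### The Malcev-Neumann ring as an algebra over `F((ker ε))` -/

section Algebra

theorem Set.IsPWO.preimage_of_le {α β : Type*} [Preorder α] [Preorder β] {s : Set β}
    (hs : s.IsPWO) (f : α → β) (hf : ∀ a b, f a ≤ f b → a ≤ b) : (f ⁻¹' s).IsPWO := by
  intro g
  obtain ⟨m, n, hmn, h⟩ := hs fun n => ⟨f (g n), (g n).2⟩
  exact ⟨m, n, hmn, hf _ _ h⟩

variable {F K A : Type*} [Field F] [Field K] [Algebra F K] [Ring A] [Algebra F A]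
variable {Γ : Type*} [AddCommGroup Γ] [LinearOrder Γ] [IsOrderedAddMonoid Γ]
variable {ι : K →ₐ[F] A} {d : ConjugatingUnits ι} {ε : Γ →+ Additive Gal(K/F)}

namespace MalcevNeumann

variable (d ε) in
/-- The series `a_γ r`. -/
noncomputable def monomial (γ : Γ) (r : fieldCentralizer ι) : MalcevNeumann d ε :=
  ⟨HahnSeries.single γ r⟩

theorem coeff_monomial (γ δ : Γ) (r : fieldCentralizer ι) :
    (monomial d ε γ r).coeff δ = if δ = γ then r else 0 := by
  change (HahnSeries.single γ r).coeff δ = _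
  split_ifs with h
  · subst h; exact HahnSeries.coeff_single_same _ _
  · exact HahnSeries.coeff_single_of_ne h

theorem toHahnSeries_monomial (γ : Γ) (r : fieldCentralizer ι) :
    (monomial d ε γ r).toHahnSeries = HahnSeries.single γ ((d.u (ε γ).toMul : A) * r) := by
  ext δ
  rw [coeff_toHahnSeries, coeff_monomial, HahnSeries.coeff_single]
  split_ifs with h
  · rw [h]
  · simp

variable [IsMulCommutative Gal(K/F)]

/-- In the Hahn series over `A` the variable is central, so the cocycle disappears from computations
with coefficients. -/
theorem u_mul_coeff_mul (x y : MalcevNeumann d ε) (γ : Γ) :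
    (d.u (ε γ).toMul : A) * (x * y).coeff γ = (x.toHahnSeries * y.toHahnSeries).coeff γ := by
  rw [← toHahnSeries_mul, coeff_toHahnSeries]

theorem u_mul_coeff_mul_monomial (x : MalcevNeumann d ε) (γ δ : Γ) (r : fieldCentralizer ι) :
    (d.u (ε (γ + δ)).toMul : A) * (x * monomial d ε δ r).coeff (γ + δ) =
      (d.u (ε γ).toMul : A) * x.coeff γ * ((d.u (ε δ).toMul : A) * r) := by
  rw [u_mul_coeff_mul, toHahnSeries_monomial, HahnSeries.coeff_mul_single_add]
  rfl

theorem u_mul_coeff_monomial_mul (x : MalcevNeumann d ε) (γ δ : Γ) (r : fieldCentralizer ι) :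
    (d.u (ε (γ + δ)).toMul : A) * (monomial d ε δ r * x).coeff (γ + δ) =
      (d.u (ε δ).toMul : A) * r * ((d.u (ε γ).toMul : A) * x.coeff γ) := by
  rw [u_mul_coeff_mul, toHahnSeries_monomial, add_comm γ, add_comm δ,
    HahnSeries.coeff_single_mul_add]
  rfl

/-! #### Leading coefficients -/

theorem coeff_mul_eq_zero {x y : MalcevNeumann d ε} {γ δ : Γ} (hx : ∀ a < γ, x.coeff a = 0)
    (hy : ∀ a < δ, y.coeff a = 0) : ∀ a < γ + δ, (x * y).coeff a = 0 := by
  intro a ha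
  rw [coeff_mul]
  refine Finset.sum_eq_zero fun ij hij => ?_
  rw [Finset.mem_antidiagonal] at hij
  have h1 : γ ≤ ij.1 := not_lt.1 fun h => hij.1 (hx _ h)
  have h2 : δ ≤ ij.2 := not_lt.1 fun h => hij.2.1 (hy _ h)
  exact absurd (add_le_add h1 h2) (by rw [hij.2.2]; exact not_le.2 ha)

/-- Exponents at least `γ` and `δ` can add up to `γ + δ` only if both are equal to their bounds. -/
theorem coeff_mul_add {x y : MalcevNeumann d ε} {γ δ : Γ} (hx : ∀ a < γ, x.coeff a = 0)
    (hy : ∀ a < δ, y.coeff a = 0) :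
    (x * y).coeff (γ + δ) = d.cocycle (ε γ).toMul (ε δ).toMul *
      d.conj (ε δ).toMul (x.coeff γ) * y.coeff δ := by
  rw [coeff_mul]
  refine Finset.sum_eq_single (γ, δ) (fun ij hij hne => ?_) fun hnot => ?_
  · rw [Finset.mem_antidiagonal] at hij
    have h1 : γ ≤ ij.1 := not_lt.1 fun h => hij.1 (hx _ h)
    have h2 : δ ≤ ij.2 := not_lt.1 fun h => hij.2.1 (hy _ h)
    refine (hne ?_).elim
    have h3 := (add_eq_add_iff_eq_and_eq h1 h2).1 hij.2.2.symm
    exact Prod.ext h3.1.symm h3.2.symm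
  · rw [Finset.mem_antidiagonal] at hnot
    by_cases hx0 : x.coeff γ = 0
    · have : d.conj (ε δ).toMul (0 : fieldCentralizer ι) = 0 :=
        Subtype.ext (by simp [ConjugatingUnits.conj])
      simp [hx0, this]
    by_cases hy0 : y.coeff δ = 0
    · simp [hy0]
    exact (hnot ⟨hx0, hy0, rfl⟩).elim

/-- The leading term of a product, computed in `A`. -/
theorem u_mul_coeff_mul_add {x y : MalcevNeumann d ε} {γ δ : Γ} (hx : ∀ a < γ, x.coeff a = 0)
    (hy : ∀ a < δ, y.coeff a = 0) :
    (d.u (ε (γ + δ)).toMul : A) * (x * y).coeff (γ + δ) =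
      (d.u (ε γ).toMul : A) * x.coeff γ * ((d.u (ε δ).toMul : A) * y.coeff δ) := by
  have h : (ε (γ + δ)).toMul = (ε γ).toMul * (ε δ).toMul := by rw [map_add]; rfl
  rw [coeff_mul_add hx hy, h]
  simp [ConjugatingUnits.cocycle, ConjugatingUnits.conj, mul_assoc]

theorem exists_leading {x : MalcevNeumann d ε} (hx : x ≠ 0) :
    ∃ γ, x.coeff γ ≠ 0 ∧ ∀ a < γ, x.coeff a = 0 := by
  have hs : x.series ≠ 0 := fun h => hx (MalcevNeumann.ext h)
  obtain ⟨g, hg⟩ := WithTop.ne_top_iff_exists.1 (HahnSeries.orderTop_ne_top.2 hs)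
  refine ⟨g, HahnSeries.coeff_orderTop_ne hg.symm, fun a ha => ?_⟩
  exact HahnSeries.coeff_eq_zero_of_lt_orderTop (by rw [← hg]; exact_mod_cast ha)

theorem coeff_mul_add_ne_zero (hC : IsDivisionAlgebra (fieldCentralizer ι))
    {x y : MalcevNeumann d ε} {γ δ : Γ} (hx : ∀ a < γ, x.coeff a = 0)
    (hy : ∀ a < δ, y.coeff a = 0) (hx0 : x.coeff γ ≠ 0) (hy0 : y.coeff δ ≠ 0) :
    (x * y).coeff (γ + δ) ≠ 0 := by
  intro h
  have key := u_mul_coeff_mul_add hx hy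
  obtain ⟨a, ha⟩ := (hC.2 _ hx0).map (fieldCentralizer ι).val
  rw [h, ZeroMemClass.coe_zero, mul_zero, ← mul_assoc, eq_comm] at key
  have ha' : (x.coeff γ : A) = a := ha.symm
  rw [ha', ← Units.val_mul, ← Units.val_mul, Units.mul_right_eq_zero] at key
  exact hy0 (Subtype.ext key)

theorem noZeroDivisors (hC : IsDivisionAlgebra (fieldCentralizer ι)) :
    NoZeroDivisors (MalcevNeumann d ε) where
  eq_zero_or_eq_zero_of_mul_eq_zero {x y} h := by
    by_contra! hne
    obtain ⟨γ, hγ, hx⟩ := exists_leading hne.1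
    obtain ⟨δ, hδ, hy⟩ := exists_leading hne.2
    exact coeff_mul_add_ne_zero hC hx hy hγ hδ (by rw [h, coeff_zero])

/-! #### The algebra structure -/

/-- The embedding of the Hahn series field `F((ker ε))` into the series over `A`. -/
noncomputable def kerEmbedding (A : Type*) [Ring A] [Algebra F A]
    (ε : Γ →+ Additive Gal(K/F)) : HahnSeries ε.ker F →+* HahnSeries Γ A where
  toFun z := (HahnSeries.embDomainRingHom ε.ker.subtype Subtype.val_injective
    (fun _ _ => Iff.rfl) z).map (algebraMap F A)
  map_zero' := by rw [map_zero]; ext; simp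
  map_one' := by rw [map_one]; exact HahnSeries.map_one (algebraMap F A).toMonoidWithZeroHom
  map_add' x y := by rw [map_add]; ext; simp
  map_mul' x y := by rw [map_mul]; exact HahnSeries.map_mul (algebraMap F A : F →ₙ+* A)

theorem coeff_kerEmbedding_of_notMem (z : HahnSeries ε.ker F) {γ : Γ} (h : γ ∉ ε.ker) :
    (kerEmbedding A ε z).coeff γ = 0 := by
  refine (congrArg (algebraMap F A) (HahnSeries.embDomain_of_notMem_range ?_)).trans (map_zero _)
  rintro ⟨a, rfl⟩
  exact h a.2

/-- Both the coefficients from `F` and the variable are central. -/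
theorem kerEmbedding_commute (z : HahnSeries ε.ker F) (x : HahnSeries Γ A) :
    kerEmbedding A ε z * x = x * kerEmbedding A ε z := by
  ext γ
  rw [HahnSeries.coeff_mul, HahnSeries.coeff_mul]
  refine Finset.sum_nbij' Prod.swap Prod.swap ?_ ?_ (fun _ _ => rfl) (fun _ _ => rfl) ?_
  · intro a
    simp only [Finset.mem_antidiagonal, Prod.fst_swap, Prod.snd_swap]
    rintro ⟨h1, h2, h3⟩
    exact ⟨h2, h1, by rw [add_comm, h3]⟩
  · intro a
    simp only [Finset.mem_antidiagonal, Prod.fst_swap, Prod.snd_swap]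
    rintro ⟨h1, h2, h3⟩
    exact ⟨h2, h1, by rw [add_comm, h3]⟩
  · exact fun a _ => Algebra.commutes _ _

variable (d ε) in
/-- The embedding of the Hahn series field `F((ker ε))` into the Malcev-Neumann ring. -/
noncomputable def baseHom : HahnSeries ε.ker F →+* MalcevNeumann d ε :=
  let f : HahnSeries ε.ker F → MalcevNeumann d ε := fun z =>
    ⟨(HahnSeries.embDomainRingHom ε.ker.subtype Subtype.val_injective
      (fun _ _ => Iff.rfl) z).map (algebraMap F (fieldCentralizer ι))⟩
  have hf : ∀ z, (f z).toHahnSeries = kerEmbedding A ε z := fun z => by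
    ext γ
    by_cases h : γ ∈ ε.ker
    · have h' : ε γ = 0 := h
      rw [coeff_toHahnSeries, h', toMul_zero, d.u_one, Units.val_one, one_mul]
      rfl
    · have h0 : (f z).coeff γ = 0 := by
        refine (congrArg (algebraMap F _) (HahnSeries.embDomain_of_notMem_range ?_)).trans
          (map_zero _)
        rintro ⟨a, rfl⟩
        exact h a.2
      rw [coeff_toHahnSeries, coeff_kerEmbedding_of_notMem z h, h0, ZeroMemClass.coe_zero,
        mul_zero]
  { toFun := f
    map_zero' := toHahnSeries_injective (by rw [hf, map_zero, toHahnSeries_zero])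
    map_one' := toHahnSeries_injective (by rw [hf, map_one, toHahnSeries_one])
    map_add' := fun x y => toHahnSeries_injective (by
      rw [hf, map_add, toHahnSeries_add, hf, hf])
    map_mul' := fun x y => toHahnSeries_injective (by
      rw [hf, map_mul, toHahnSeries_mul, hf, hf]) }

theorem coeff_baseHom (z : HahnSeries ε.ker F) (γ : ε.ker) :
    (baseHom d ε z).coeff γ = algebraMap F (fieldCentralizer ι) (z.coeff γ) :=
  congrArg (algebraMap F _) (HahnSeries.embDomain_coeff (a := γ))

theorem coeff_baseHom_of_notMem (z : HahnSeries ε.ker F) {γ : Γ} (h : γ ∉ ε.ker) :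
    (baseHom d ε z).coeff γ = 0 := by
  refine (congrArg (algebraMap F _) (HahnSeries.embDomain_of_notMem_range ?_)).trans (map_zero _)
  rintro ⟨a, rfl⟩
  exact h a.2

theorem toHahnSeries_baseHom (z : HahnSeries ε.ker F) :
    (baseHom d ε z).toHahnSeries = kerEmbedding A ε z := by
  ext γ
  by_cases h : γ ∈ ε.ker
  · have h' : ε γ = 0 := h
    rw [coeff_toHahnSeries, h', toMul_zero, d.u_one, Units.val_one, one_mul]
    rfl
  · rw [coeff_toHahnSeries, coeff_kerEmbedding_of_notMem z h, coeff_baseHom_of_notMem z h,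
      ZeroMemClass.coe_zero, mul_zero]

noncomputable instance : Algebra (HahnSeries ε.ker F) (MalcevNeumann d ε) :=
  (baseHom d ε).toAlgebra' fun z x => toHahnSeries_injective (by
    rw [toHahnSeries_mul, toHahnSeries_mul, toHahnSeries_baseHom, kerEmbedding_commute])

theorem algebraMap_eq (z : HahnSeries ε.ker F) :
    algebraMap (HahnSeries ε.ker F) (MalcevNeumann d ε) z = baseHom d ε z := rfl

theorem mem_laurentBase_iff {x : MalcevNeumann d ε} :
    x ∈ laurentBase d ε ↔ ∃ z, baseHom d ε z = x := by
  constructor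
  · classical
    intro hx
    choose c hc using fun γ => (hx γ).1
    refine ⟨⟨fun γ => if x.coeff γ = 0 then 0 else c γ, (x.series.isPWO_support.preimage_of_le
      (Subtype.val : ε.ker → Γ) fun _ _ h => h).mono fun γ hγ h0 => hγ (if_pos h0)⟩, ?_⟩
    refine ext_coeff fun γ => ?_
    by_cases h : γ ∈ ε.ker
    · refine (coeff_baseHom _ ⟨γ, h⟩).trans ?_
      simp only
      split_ifs with h0
      · rw [h0, map_zero]
      · exact hc γ
    · rw [coeff_baseHom_of_notMem _ h, (hx γ).2 h]
  · rintro ⟨z, rfl⟩ γ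
    by_cases h : γ ∈ ε.ker
    · exact ⟨⟨_, (coeff_baseHom z ⟨γ, h⟩).symm⟩, fun h' => (h' h).elim⟩
    · rw [coeff_baseHom_of_notMem z h]
      exact ⟨zero_mem _, fun _ => rfl⟩

/-- The twist is trivial here: `u_id = 1` kills the cocycle, and conjugation fixes `F`. -/
theorem coeff_smul (z : HahnSeries ε.ker F) (x : MalcevNeumann d ε) (γ : Γ) :
    (z • x).coeff γ = ∑ ij ∈ Finset.antidiagonal (baseHom d ε z).series.isPWO_support
      x.series.isPWO_support γ, (baseHom d ε z).coeff ij.1 * x.coeff ij.2 := by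
  rw [Algebra.smul_def, algebraMap_eq, coeff_mul]
  refine Finset.sum_congr rfl fun ij hij => ?_
  rw [Finset.mem_antidiagonal] at hij
  have hker : ij.1 ∈ ε.ker := by
    by_contra h
    exact hij.1 (coeff_baseHom_of_notMem z h)
  have hc := coeff_baseHom (d := d) z ⟨ij.1, hker⟩
  have h0 : ε ij.1 = 0 := hker
  simp only at hc
  rw [hc, h0]
  apply Subtype.ext
  simp [ConjugatingUnits.cocycle, ConjugatingUnits.conj, d.u_one,
    ← Algebra.commutes (z.coeff ⟨ij.1, hker⟩) (↑(d.u (ε ij.2).toMul)⁻¹ : A), mul_assoc]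

variable (d ε) in
/-- The `F((ker ε))`-linear functional `x ↦ ∑_δ p (x_{γ+δ}) t^δ` induced by an `F`-linear
functional `p` on `C_A(K)`. -/
noncomputable def functional (γ : Γ) (p : fieldCentralizer ι →ₗ[F] F) :
    MalcevNeumann d ε →ₗ[HahnSeries ε.ker F] HahnSeries ε.ker F where
  toFun x := ⟨fun δ => p (x.coeff (γ + δ)), (x.series.isPWO_support.preimage_of_le
    (fun δ : ε.ker => γ + (δ : Γ)) fun _ _ h => (add_le_add_iff_left γ).1 h).mono fun δ hδ h0 =>
      hδ ((congrArg p (show x.coeff (γ + δ) = 0 from h0)).trans (map_zero p))⟩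
  map_add' x y := by ext δ; simp
  map_smul' z x := by
    ext δ
    rw [RingHom.id_apply, smul_eq_mul, HahnSeries.coeff_mul]
    simp only [coeff_smul, map_sum]
    symm
    -- The index sets need not correspond bijectively, since `p` may kill nonzero coefficients of
    -- `x`; the extra terms vanish.
    refine Finset.sum_of_injOn (fun ij => ((ij.1 : Γ), γ + (ij.2 : Γ))) ?_ ?_ ?_ ?_
    · rintro ⟨a, b⟩ - ⟨a', b'⟩ - h
      simpa using h
    · rintro ⟨a, b⟩ h
      rw [Finset.mem_coe, Finset.mem_antidiagonal] at h ⊢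
      refine ⟨fun h0 => h.1 ?_, fun h0 => h.2.1 ?_, ?_⟩
      · have := coeff_baseHom (d := d) z a
        rw [show (baseHom d ε z).coeff a = 0 from h0] at this
        have hnt : Nontrivial (fieldCentralizer ι) := by
          refine ⟨x.coeff (γ + b), 0, fun h0 => h.2.1 ((congrArg p h0).trans (map_zero p))⟩
        exact (map_eq_zero _).1 this.symm
      · exact (congrArg p (show x.coeff (γ + b) = 0 from h0)).trans (map_zero p)
      · rw [← h.2.2]; push_cast; abel
    · rintro ⟨a, b⟩ h hnot
      rw [Finset.mem_antidiagonal] at h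
      have ha : a ∈ ε.ker := by
        by_contra h'
        exact h.1 (coeff_baseHom_of_notMem z h')
      have hpa : p ((baseHom d ε z).coeff a * x.coeff b) =
          z.coeff ⟨a, ha⟩ * p (x.coeff b) := by
        rw [coeff_baseHom z ⟨a, ha⟩, ← Algebra.smul_def, map_smul, smul_eq_mul]
      by_contra hne
      rw [hpa] at hne
      have hb : b - γ ∈ ε.ker := by
        have : b - γ = δ - a := by
          have := h.2.2
          simp only at this
          rw [sub_eq_sub_iff_add_eq_add, add_comm b, this, add_comm]
        rw [this]
        exact sub_mem δ.2 ha
      refine hnot ⟨(⟨a, ha⟩, ⟨b - γ, hb⟩), ?_, by simp⟩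
      rw [Finset.mem_coe, Finset.mem_antidiagonal]
      refine ⟨left_ne_zero_of_mul hne, ?_, Subtype.ext ?_⟩
      · refine fun h0 => right_ne_zero_of_mul hne (Eq.trans ?_ h0)
        simp
      · have := h.2.2
        simp only at this
        simp [← add_sub_assoc, this]
    · rintro ⟨a, b⟩ h
      simp only
      rw [coeff_baseHom, ← Algebra.smul_def, map_smul, smul_eq_mul]

end MalcevNeumann

end Algebra

/-! ### The dimension and the centre of the Malcev-Neumann ring -/

section Dimension

variable {F K A : Type*} [Field F] [Field K] [Algebra F K] [Ring A] [Algebra F A]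
variable {Γ : Type*} [AddCommGroup Γ] [LinearOrder Γ] [IsOrderedAddMonoid Γ]
variable {ι : K →ₐ[F] A} {d : ConjugatingUnits ι} {ε : Γ →+ Additive Gal(K/F)}
variable [IsMulCommutative Gal(K/F)]

namespace MalcevNeumann

/-- A set of representatives of `Γ / ker ε`. -/
noncomputable def rep (hε : Function.Surjective ε) (σ : Gal(K/F)) : Γ :=
  Function.surjInv hε (Additive.ofMul σ)

theorem map_rep (hε : Function.Surjective ε) (σ : Gal(K/F)) :
    ε (rep hε σ) = Additive.ofMul σ := Function.surjInv_eq hε _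

theorem toMul_map_rep (hε : Function.Surjective ε) (σ : Gal(K/F)) :
    (ε (rep hε σ)).toMul = σ := by rw [map_rep]; rfl

theorem sub_rep_mem (hε : Function.Surjective ε) (γ : Γ) :
    γ - rep hε (ε γ).toMul ∈ ε.ker := by
  rw [AddMonoidHom.mem_ker, map_sub, map_rep, ofMul_toMul, sub_self]

variable [FiniteDimensional F K]

/-- If the leading coefficients of a subspace `W` of the Malcev-Neumann ring in degree `γ` lie in a
space `P (ε γ)`, then `W` has dimension at most `∑ dim (P σ)`. -/
theorem exists_injective_of_leading_mem [FiniteDimensional F (fieldCentralizer ι)]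
    (hε : Function.Surjective ε)
    (W : Submodule (HahnSeries ε.ker F) (MalcevNeumann d ε))
    (P : Gal(K/F) → Submodule F (fieldCentralizer ι))
    (hP : ∀ x ∈ W, ∀ γ, (∀ a < γ, x.coeff a = 0) → x.coeff γ ∈ P (ε γ).toMul) :
    ∃ f : W →ₗ[HahnSeries ε.ker F]
      ((Σ σ : Gal(K/F), Fin (Module.finrank F (P σ))) → HahnSeries ε.ker F),
      Function.Injective f := by
  choose p hp using fun σ => (P σ).subtype.exists_leftInverse_of_injective (P σ).ker_subtype
  let f : W →ₗ[HahnSeries ε.ker F]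
      ((Σ σ : Gal(K/F), Fin (Module.finrank F (P σ))) → HahnSeries ε.ker F) :=
    -- For each coset of `ker ε`, project the coefficients to `P σ` and take coordinates. The
    -- leading coefficient of a nonzero element of `W` already lies in its `P σ`, so some coordinate
    -- detects it.
    LinearMap.pi fun i => (functional d ε (rep hε i.1)
      ((Module.finBasis F (P i.1)).coord i.2 ∘ₗ p i.1)) ∘ₗ W.subtype
  refine ⟨f, (injective_iff_map_eq_zero f).2 fun x hx => ?_⟩
  by_contra hne
  have hne' : (x : MalcevNeumann d ε) ≠ 0 := fun h => hne (Subtype.ext h)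
  obtain ⟨γ, hγ, hlt⟩ := exists_leading hne'
  have hmem := hP x x.2 γ hlt
  have hp0 : p (ε γ).toMul ((x : MalcevNeumann d ε).coeff γ) = 0 := by
    refine (Module.finBasis F (P (ε γ).toMul)).ext_elem fun i => ?_
    have h1 := congrArg (fun z => z.coeff ⟨_, sub_rep_mem hε γ⟩) (congrFun hx ⟨(ε γ).toMul, i⟩)
    have h2 : (Module.finBasis F (P (ε γ).toMul)).coord i (p (ε γ).toMul
        ((x : MalcevNeumann d ε).coeff
          (rep hε (ε γ).toMul + (γ - rep hε (ε γ).toMul)))) = 0 := h1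
    rw [add_sub_cancel] at h2
    rw [map_zero]
    exact h2
  have := congrArg (fun g => g ⟨_, hmem⟩) (hp (ε γ).toMul)
  simp only [LinearMap.comp_apply, Submodule.subtype_apply, LinearMap.id_apply] at this
  rw [hp0] at this
  exact hγ (congrArg Subtype.val this.symm)

theorem finiteDimensional [FiniteDimensional F (fieldCentralizer ι)]
    (hε : Function.Surjective ε) :
    FiniteDimensional (HahnSeries ε.ker F) (MalcevNeumann d ε) := by
  obtain ⟨f, hf⟩ := exists_injective_of_leading_mem (d := d) hε ⊤ (fun _ => ⊤)
    (fun _ _ _ _ => trivial)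
  have : FiniteDimensional (HahnSeries ε.ker F)
    (⊤ : Submodule (HahnSeries ε.ker F) (MalcevNeumann d ε)) :=
    FiniteDimensional.of_injective f hf
  exact Module.Finite.equiv Submodule.topEquiv

/-- The monomials `a_γ b`, with `γ` a coset representative and `b` in an `F`-basis, have a dual
family of functionals. -/
theorem card_mul_finrank_le_finrank [FiniteDimensional F (fieldCentralizer ι)]
    (hε : Function.Surjective ε) :
    Nat.card Gal(K/F) * Module.finrank F (fieldCentralizer ι) ≤
      Module.finrank (HahnSeries ε.ker F) (MalcevNeumann d ε) := by
  classical
  have := finiteDimensional (d := d) hε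
  let b := Module.finBasis F (fieldCentralizer ι)
  let e : Gal(K/F) × Fin (Module.finrank F (fieldCentralizer ι)) → MalcevNeumann d ε :=
    fun i => monomial d ε (rep hε i.1) (b i.2)
  have hdual : ∀ i j, functional d ε (rep hε i.1) (b.coord i.2) (e j) =
      if j = i then 1 else 0 := by
    rintro ⟨σ, k⟩ ⟨τ, l⟩
    ext δ
    change b.coord k ((e (τ, l)).coeff (rep hε σ + δ)) = _
    simp only [e, coeff_monomial]
    by_cases hστ : τ = σ
    · subst hστ
      by_cases hδ : δ = 0
      · subst hδ
        by_cases hlk : l = k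
        · subst hlk; simp
        · simp [hlk]
      · have : (δ : Γ) ≠ 0 := fun h => hδ (Subtype.ext h)
        rw [if_neg (by simpa using this)]
        split_ifs <;> simp [hδ, HahnSeries.coeff_one]
    · have hne : rep hε σ + δ ≠ rep hε τ := fun h => hστ (by
        have hδ : ε δ = 0 := δ.2
        have := congrArg ε h
        rw [map_add, hδ, add_zero, map_rep, map_rep] at this
        exact this.symm)
      rw [if_neg hne, if_neg (by simp [hστ])]
      simp
  have hli : LinearIndependent (HahnSeries ε.ker F) e := by
    rw [Fintype.linearIndependent_iff]
    intro g hg i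
    have := congrArg (functional d ε (rep hε i.1) (b.coord i.2)) hg
    simpa [map_sum, hdual] using this
  have := hli.fintype_card_le_finrank
  rwa [Fintype.card_prod, Fintype.card_fin, ← Nat.card_eq_fintype_card] at this

/-- A finite-dimensional algebra without zero divisors over a field is a division algebra. -/
theorem isDivisionAlgebra [FiniteDimensional F (fieldCentralizer ι)]
    (hC : IsDivisionAlgebra (fieldCentralizer ι)) (hε : Function.Surjective ε) :
    IsDivisionAlgebra (MalcevNeumann d ε) := by
  have := finiteDimensional (d := d) hε
  have := noZeroDivisors (d := d) (ε := ε) hC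
  have := hC.1
  have : Nontrivial (MalcevNeumann d ε) := ⟨1, 0, fun h => by
    have := congrArg (fun x => x.coeff 0) h
    simp [coeff_one] at this⟩
  have : IsDomain (MalcevNeumann d ε) := NoZeroDivisors.to_isDomain _
  exact ⟨this.toNontrivial, fun x hx => FiniteDimensional.isUnit (HahnSeries ε.ker F) hx⟩

/-- The centre of the Malcev-Neumann ring is contained in `F((ker ε))`. -/
theorem mem_laurentBase_of_commute [IsGalois F K] [Algebra.IsCentral F A]
    (hε : Function.Surjective ε) {x : MalcevNeumann d ε} (hx : ∀ y, y * x = x * y) :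
    x ∈ laurentBase d ε := by
  rcases subsingleton_or_nontrivial A with hA | hA
  · rw [show x = 0 from ext_coeff fun γ => Subtype.ext (Subsingleton.elim _ _)]
    exact zero_mem _
  intro γ
  -- Commuting with `a_0 s` and with `a_δ` for `δ` above `σ` makes each term `u_{ε γ} x_γ` central
  -- in `A`, hence a scalar.
  have h1 : ∀ s ∈ fieldCentralizer ι, s * ((d.u (ε γ).toMul : A) * x.coeff γ) =
      (d.u (ε γ).toMul : A) * x.coeff γ * s := by
    intro s hs
    have e1 := u_mul_coeff_mul_monomial x γ 0 ⟨s, hs⟩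
    rw [← hx, u_mul_coeff_monomial_mul] at e1
    simpa [d.u_one] using e1
  have h2 : ∀ σ, (d.u σ : A) * ((d.u (ε γ).toMul : A) * x.coeff γ) =
      (d.u (ε γ).toMul : A) * x.coeff γ * d.u σ := by
    intro σ
    have e1 := u_mul_coeff_mul_monomial x γ (rep hε σ) 1
    rw [← hx, u_mul_coeff_monomial_mul] at e1
    simpa [toMul_map_rep] using e1
  obtain ⟨f, hf⟩ := d.mem_range_of_commute h1 h2
  by_cases hf0 : f = 0
  · rw [hf0, map_zero, eq_comm, Units.mul_right_eq_zero] at hf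
    rw [show x.coeff γ = 0 from Subtype.ext hf]
    exact ⟨zero_mem _, fun _ => rfl⟩
  -- A nonzero scalar commutes with `K`, while moving `K` past `u_σ x_γ` applies `σ`.
  · have hσ : (ε γ).toMul = 1 := by
      ext k
      have e1 : algebraMap F A f * ι k = algebraMap F A f * ι ((ε γ).toMul k) := by
        rw [Algebra.commutes, hf, ← mul_assoc, d.comm_u, mul_assoc, mul_assoc,
          ConjugatingUnits.mem_iff.1 (x.coeff γ).2]
      have hu : IsUnit (algebraMap F A f) := (IsUnit.mk0 f hf0).map _
      exact (ι.injective (hu.mul_left_cancel e1)).symm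
    refine ⟨⟨f, Subtype.ext ?_⟩, fun h => (h ?_).elim⟩
    · rw [hσ, d.u_one, Units.val_one, one_mul] at hf
      exact hf
    · exact congrArg Additive.ofMul hσ

end MalcevNeumann

end Dimension

/-! ### Residue fields and dimensions -/

section Abstract

/-- A field `M ⊇ K` in a division algebra `E` with centre `K ⊇ F` satisfies
`[M : F]² ≤ [K : F] [E : F]`. -/
theorem IsDivisionAlgebra.sq_finrank_le_mul {F K E : Type*} [Field F] [Field K] [Ring E]
    [Algebra F K] [Algebra K E] [Algebra F E] [IsScalarTower F K E] [FiniteDimensional F E]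
    (hE : IsDivisionAlgebra E)
    (hcenter : ∀ c : E, (∀ x, x * c = c * x) → c ∈ Set.range (algebraMap K E))
    (M : Subalgebra K E) (hM : IsField M) :
    Module.finrank F M ^ 2 ≤ Module.finrank F K * Module.finrank F E := by
  have : FiniteDimensional K E := Module.Finite.of_restrictScalars_finite F K E
  let : Field M := hM.toField
  have h := hE.sq_finrank_le hcenter M.val
  rw [← Module.finrank_mul_finrank F K M, ← Module.finrank_mul_finrank F K E, mul_pow, sq, mul_assoc]
  gcongr

/-- Distinct restrictions to `M` of `R`-fixing endomorphisms bound the degree `[M : R]`. -/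
theorem Subalgebra.card_mul_finrank_le {F E T : Type*} [Field F] [Ring E] [Algebra F E]
    [FiniteDimensional F E] {R M : Subalgebra F E} (hRM : R ≤ M) (hR : IsField R) (hM : IsField M)
    (φ : T → E →+* E) (hmaps : ∀ t, ∀ m ∈ M, φ t m ∈ M) (hfix : ∀ t, ∀ r ∈ R, φ t r = r)
    (hinj : ∀ t t', (∀ m ∈ M, φ t m = φ t' m) → t = t') :
    Nat.card T * Module.finrank F R ≤ Module.finrank F M := by
  let : Field R := hR.toField
  let : Field M := hM.toField
  let : Algebra R M := (Subalgebra.inclusion hRM).toRingHom.toAlgebra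
  have : IsScalarTower F R M := IsScalarTower.of_algebraMap_eq fun _ => rfl
  have : FiniteDimensional R M := Module.Finite.of_restrictScalars_finite F R M
  let ψ : T → M →ₐ[R] M := fun t =>
    { (φ t).restrict M.toSubring M.toSubring (hmaps t) with
      commutes' := fun r => Subtype.ext (hfix t r r.2) }
  have hψ : Function.Injective ψ := fun t t' h => hinj t t' fun m hm => by
    have := DFunLike.congr_fun h (⟨m, hm⟩ : M)
    exact congrArg Subtype.val this
  have hcard : Nat.card T ≤ Module.finrank R M :=
    (Nat.card_le_card_of_injective ψ hψ).trans (card_algHom_le_finrank R M M)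
  rw [← Module.finrank_mul_finrank F R M, mul_comm]
  exact Nat.mul_le_mul_left _ hcard

/-- A commutative subalgebra of a finite-dimensional division algebra is a field. -/
theorem Subalgebra.isField_of_commute {F E : Type*} [Field F] [Ring E] [Algebra F E]
    [FiniteDimensional F E] (hE : IsDivisionAlgebra E) (S : Subalgebra F E)
    (hS : ∀ x ∈ S, ∀ y ∈ S, x * y = y * x) : IsField S := by
  have := hE.1
  let := hE.divisionRing
  refine S.toSubring.isField_of_isUnit hS fun x hx hx0 => ?_
  have hu : IsUnit (⟨x, hx⟩ : S) :=
    FiniteDimensional.isUnit F fun h => hx0 (congrArg Subtype.val h)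
  obtain ⟨y, hy⟩ := hu.exists_right_inv
  exact ⟨y, y.2, congrArg Subtype.val hy⟩

theorem Subring.commute_of_mem_sup {E : Type*} [Ring E] {R S : Subring E}
    (hR : ∀ x ∈ R, ∀ y ∈ R, x * y = y * x) (hS : ∀ x ∈ S, ∀ y, x * y = y * x) :
    ∀ x ∈ R ⊔ S, ∀ y ∈ R ⊔ S, x * y = y * x := by
  have hle : R ⊔ S ≤ Subring.centralizer (R : Set E) :=
    sup_le (fun x hx => Subring.mem_centralizer_iff.2 fun y hy => hR y hy x hx)
      (fun x hx => Subring.mem_centralizer_iff.2 fun y _ => (hS x hx y).symm)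
  have hle' : R ⊔ S ≤ Subring.centralizer ((R ⊔ S : Subring E) : Set E) :=
    sup_le (fun x hx => Subring.mem_centralizer_iff.2 fun y hy =>
        (Subring.mem_centralizer_iff.1 (hle hy) x hx).symm)
      (fun x hx => Subring.mem_centralizer_iff.2 fun y _ => (hS x hx y).symm)
  exact fun x hx y hy => Subring.mem_centralizer_iff.1 (hle' hy) x hx

end Abstract

/-! ### Leading coefficients, value classes and maximality of the compositum -/

section Residue

variable {F K A : Type*} [Field F] [Field K] [Algebra F K] [Ring A] [Algebra F A]
variable {ι : K →ₐ[F] A}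

theorem Subring.mem_sup_left_of_mem {E : Type*} [Ring E] {R S : Subring E} {x : E} (h : x ∈ R) :
    x ∈ R ⊔ S := (le_sup_left : R ≤ R ⊔ S) h

theorem Subring.mem_sup_right_of_mem {E : Type*} [Ring E] {R S : Subring E} {x : E} (h : x ∈ S) :
    x ∈ R ⊔ S := (le_sup_right : S ≤ R ⊔ S) h

theorem mem_fieldInCentralizer {r : fieldCentralizer ι} :
    r ∈ fieldInCentralizer ι ↔ ∃ k, ι k = r := Iff.rfl

theorem commute_of_mem_fieldInCentralizer {r : fieldCentralizer ι} (hr : r ∈ fieldInCentralizer ι)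
    (s : fieldCentralizer ι) : r * s = s * r := by
  obtain ⟨k, hk⟩ := mem_fieldInCentralizer.1 hr
  apply Subtype.ext
  rw [MulMemClass.coe_mul, MulMemClass.coe_mul, ← hk, ConjugatingUnits.mem_iff.1 s.2]

theorem algebraMap_mem_fieldInCentralizer (c : F) :
    algebraMap F (fieldCentralizer ι) c ∈ fieldInCentralizer ι :=
  mem_fieldInCentralizer.2 ⟨algebraMap F K c, ι.commutes c⟩

/-- `C_A(K)` becomes a `K`-algebra with centre `K`, because its centralizer in `A` is `K`. -/
theorem ConjugatingUnits.sq_finrank_le [FiniteDimensional F K] [IsGalois F K]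
    [Algebra.IsCentral F A] [FiniteDimensional F (fieldCentralizer ι)]
    (d : ConjugatingUnits ι) (hC : IsDivisionAlgebra (fieldCentralizer ι))
    (M : Subalgebra F (fieldCentralizer ι)) (hKM : fieldInCentralizer ι ≤ M.toSubring)
    (hM : IsField M) :
    Module.finrank F M ^ 2 ≤ Nat.card Gal(K/F) * Module.finrank F (fieldCentralizer ι) := by
  rw [IsGalois.card_aut_eq_finrank]
  let f : K →ₐ[F] fieldCentralizer ι := ι.codRestrict _ fun x => ConjugatingUnits.mem_iff.2
    fun y => by rw [← map_mul, ← map_mul, mul_comm]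
  let : Algebra K (fieldCentralizer ι) := f.toRingHom.toAlgebra' fun k r =>
    commute_of_mem_fieldInCentralizer (mem_fieldInCentralizer.2 ⟨k, rfl⟩) r
  have : IsScalarTower F K (fieldCentralizer ι) :=
    IsScalarTower.of_algebraMap_eq fun c => (f.commutes c).symm
  let M' : Subalgebra K (fieldCentralizer ι) :=
    { M with algebraMap_mem' := fun k => hKM (mem_fieldInCentralizer.2 ⟨k, rfl⟩) }
  refine hC.sq_finrank_le_mul (fun c hc => ?_) M' hM
  obtain ⟨k, hk⟩ := d.mem_range_of_commute_centralizer (r := c) fun s hs =>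
    congrArg Subtype.val (hc ⟨s, hs⟩)
  exact ⟨k, Subtype.ext hk⟩

/-- Conjugation by a unit of `A` that normalizes `K`, as an endomorphism of `C_A(K)`. -/
def fieldCentralizer.conjHom (a : Aˣ) (σ : Gal(K/F))
    (h : ∀ k, ι k * (a : A) = a * ι (σ k)) : fieldCentralizer ι →+* fieldCentralizer ι where
  toFun r := ⟨(↑a⁻¹ : A) * r * a, ConjugatingUnits.mem_iff.2 fun x => by
    obtain ⟨y, rfl⟩ := σ.surjective x
    have h' : ι (σ y) * (↑a⁻¹ : A) = (↑a⁻¹ : A) * ι y := by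
      rw [Units.mul_inv_eq_iff_eq_mul, mul_assoc, h, Units.inv_mul_cancel_left]
    calc ι (σ y) * ((↑a⁻¹ : A) * r * a) = (↑a⁻¹ : A) * (ι y * r) * a := by
          rw [← mul_assoc, ← mul_assoc, h']; simp only [mul_assoc]
      _ = (↑a⁻¹ : A) * r * a * ι (σ y) := by
          rw [ConjugatingUnits.mem_iff.1 r.2, mul_assoc, mul_assoc, h]; simp only [mul_assoc]⟩
  map_zero' := Subtype.ext (by simp)
  map_one' := Subtype.ext (by simp)
  map_add' r s := Subtype.ext (by simp [mul_add, add_mul])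
  map_mul' r s := Subtype.ext (by simp [mul_assoc])

theorem fieldCentralizer.coe_conjHom (a : Aˣ) (σ : Gal(K/F))
    (h : ∀ k, ι k * (a : A) = a * ι (σ k)) (r : fieldCentralizer ι) :
    (fieldCentralizer.conjHom a σ h r : A) = (↑a⁻¹ : A) * r * a := rfl

variable {Γ : Type*} [AddCommGroup Γ] [LinearOrder Γ] [IsOrderedAddMonoid Γ]
variable {d : ConjugatingUnits ι} {ε : Γ →+ Additive Gal(K/F)}
variable [IsMulCommutative Gal(K/F)]

namespace MalcevNeumann

theorem baseHom_single (δ : ε.ker) (c : F) :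
    baseHom d ε (HahnSeries.single δ c) = monomial d ε δ (algebraMap F _ c) := by
  refine ext_coeff fun γ => ?_
  rw [coeff_monomial]
  by_cases h : γ ∈ ε.ker
  · rw [coeff_baseHom _ ⟨γ, h⟩, HahnSeries.coeff_single]
    simp only [Subtype.ext_iff]
    split_ifs <;> simp
  · rw [coeff_baseHom_of_notMem _ h, if_neg]
    rintro rfl
    exact h δ.2

theorem coeff_single_smul (δ : ε.ker) (c : F) (x : MalcevNeumann d ε) (γ : Γ) :
    (HahnSeries.single δ c • x).coeff (γ + δ) = c • x.coeff γ := by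
  have h := u_mul_coeff_monomial_mul x γ δ (algebraMap F _ c)
  have hδ : ε δ = 0 := δ.2
  rw [map_add, hδ, add_zero, toMul_zero, d.u_one, Units.val_one, one_mul,
    SubalgebraClass.coe_algebraMap, Algebra.commutes, mul_assoc, Units.mul_right_inj,
    ← Algebra.commutes, ← Algebra.smul_def] at h
  rw [Algebra.smul_def, algebraMap_eq, baseHom_single]
  exact Subtype.ext h

theorem smul_mem_of_laurentBase_le {L : Subring (MalcevNeumann d ε)} (hL : laurentBase d ε ≤ L)
    (z : HahnSeries ε.ker F) {x : MalcevNeumann d ε} (hx : x ∈ L) : z • x ∈ L := by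
  rw [Algebra.smul_def]
  exact mul_mem (hL (mem_laurentBase_iff.2 ⟨z, rfl⟩)) hx

/-- A subring containing `F((ker ε))`, as a subalgebra. -/
def toSubalgebra (L : Subring (MalcevNeumann d ε)) (hL : laurentBase d ε ≤ L) :
    Subalgebra (HahnSeries ε.ker F) (MalcevNeumann d ε) :=
  { L with algebraMap_mem' := fun z => hL (mem_laurentBase_iff.2 ⟨z, rfl⟩) }

/-- The `F`-space of leading coefficients in degree `γ` of the elements of `L`. -/
def leadingSpace (L : Subring (MalcevNeumann d ε)) (hL : laurentBase d ε ≤ L) (γ : Γ) :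
    Submodule F (fieldCentralizer ι) where
  carrier := {r | ∃ x ∈ L, (∀ a < γ, x.coeff a = 0) ∧ x.coeff γ = r}
  zero_mem' := ⟨0, zero_mem _, fun _ _ => rfl, rfl⟩
  add_mem' := by
    rintro _ _ ⟨x, hx, hx0, rfl⟩ ⟨y, hy, hy0, rfl⟩
    exact ⟨x + y, add_mem hx hy, fun a ha => by rw [coeff_add, hx0 a ha, hy0 a ha, add_zero], rfl⟩
  smul_mem' := by
    rintro c _ ⟨x, hx, hx0, rfl⟩
    have hco : ∀ a, (HahnSeries.single (0 : ε.ker) c • x).coeff a = c • x.coeff a := fun a => by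
      simpa using coeff_single_smul 0 c x a
    exact ⟨_, smul_mem_of_laurentBase_le hL (HahnSeries.single 0 c) hx,
      fun a ha => by rw [hco, hx0 a ha, smul_zero], hco γ⟩

/-- Multiply by the monomial of degree `δ` in `F((ker ε))`. Applied also to `-δ`, this shows that
the space depends only on `ε γ`. -/
theorem leadingSpace_le {L : Subring (MalcevNeumann d ε)} (hL : laurentBase d ε ≤ L) (γ : Γ)
    (δ : ε.ker) : leadingSpace L hL γ ≤ leadingSpace L hL (γ + δ) := by
  rintro _ ⟨x, hx, hx0, rfl⟩
  refine ⟨_, smul_mem_of_laurentBase_le hL (HahnSeries.single δ 1) hx, fun a ha => ?_, ?_⟩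
  · have := coeff_single_smul δ 1 x (a - δ)
    rw [sub_add_cancel] at this
    rw [this, hx0 _ (sub_lt_iff_lt_add.2 ha), smul_zero]
  · rw [coeff_single_smul, one_smul]

/-- The residue field of a subring containing `F((ker ε))`, as a subalgebra. -/
noncomputable def residueSubalgebra (L : Subring (MalcevNeumann d ε)) (hL : laurentBase d ε ≤ L) :
    Subalgebra F (fieldCentralizer ι) :=
  { residueField L with
    algebraMap_mem' := fun c => by
      have h : (residueField L : Set (fieldCentralizer ι)) =
        Submodule.span F (residueField L : Set (fieldCentralizer ι)) :=
        (coe_span_residueField hL).symm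
      change algebraMap F (fieldCentralizer ι) c ∈ (residueField L : Set (fieldCentralizer ι))
      rw [h, Algebra.algebraMap_eq_smul_one]
      exact Submodule.smul_mem _ _ (Submodule.subset_span (one_mem (residueField L))) }

/-- The compositum of the residue field with `K`, as a subalgebra. -/
noncomputable def compositum (L : Subring (MalcevNeumann d ε)) :
    Subalgebra F (fieldCentralizer ι) :=
  { residueField L ⊔ fieldInCentralizer ι with
    algebraMap_mem' := fun c =>
      (le_sup_right : _ ≤ residueField L ⊔ fieldInCentralizer ι)
        (algebraMap_mem_fieldInCentralizer c) }

theorem mem_compositum {L : Subring (MalcevNeumann d ε)} {r : fieldCentralizer ι} :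
    r ∈ compositum L ↔ r ∈ residueField L ⊔ fieldInCentralizer ι := Iff.rfl

/-- The elements `σ` of the Galois group such that `L` has an element of value
in `ε⁻¹(σ)`. -/
def valueGroup (hε : Function.Surjective ε) (L : Subring (MalcevNeumann d ε)) :
    Set Gal(K/F) :=
  {σ | ∃ y ∈ L, y.coeff (rep hε σ) ≠ 0 ∧ ∀ a < rep hε σ, y.coeff a = 0}

theorem mul_comm_of_isField {D : Type*} [Ring D] {L : Subring D} (hL : IsField L) :
    ∀ x ∈ L, ∀ y ∈ L, x * y = y * x := fun x hx y hy =>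
  congrArg Subtype.val (hL.mul_comm ⟨x, hx⟩ ⟨y, hy⟩)

theorem exists_mul_eq_of_isField {D : Type*} [Ring D] {L : Subring D} (hL : IsField L)
    {x y : D} (hx : x ∈ L) (hy : y ∈ L) (hy0 : y ≠ 0) : ∃ w ∈ L, y * w = x := by
  obtain ⟨b, hb⟩ := hL.mul_inv_cancel (a := ⟨y, hy⟩) fun h => hy0 (congrArg Subtype.val h)
  have hb' : y * b = 1 := congrArg Subtype.val hb
  exact ⟨b * x, mul_mem b.2 hx, by rw [← mul_assoc, hb', one_mul]⟩

/-- Dividing by one element of `L` of value `rep hε σ` carries the leading coefficients into the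
residue field; without such an element there are none. -/
theorem finrank_leadingSpace_le [FiniteDimensional F (fieldCentralizer ι)]
    (hC : IsDivisionAlgebra (fieldCentralizer ι)) (hε : Function.Surjective ε)
    {L : Subring (MalcevNeumann d ε)} (hL : laurentBase d ε ≤ L) (hfield : IsField L)
    (σ : Gal(K/F)) [Decidable (σ ∈ valueGroup hε L)] :
    Module.finrank F (leadingSpace L hL (rep hε σ)) ≤
      if σ ∈ valueGroup hε L then Module.finrank F (residueSubalgebra L hL) else 0 := by
  split_ifs with hσ
  · obtain ⟨y, hy, hne, hlt⟩ := hσ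
    have hle : leadingSpace L hL (rep hε σ) ≤
        (residueSubalgebra L hL).toSubmodule.map
          (LinearMap.mulLeft F (y.coeff (rep hε σ))) := by
      rintro _ ⟨x, hx, hx0, rfl⟩
      obtain ⟨w, hw, rfl⟩ := exists_mul_eq_of_isField hfield hx hy
        (fun h => hne (by rw [h]; rfl))
      -- The value of `y * w` is at least that of `y`, and leading coefficients multiply to
      -- something nonzero.
      have hw0 : ∀ a < 0, w.coeff a = 0 := by
        intro a ha
        by_contra hwa
        have hw' : w ≠ 0 := fun h => hwa (by rw [h]; rfl)
        obtain ⟨b, hb, hblt⟩ := exists_leading hw'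
        have hba : b ≤ a := not_lt.1 fun h => hwa (hblt a h)
        exact coeff_mul_add_ne_zero hC hlt hblt hne hb
          (hx0 _ (add_lt_of_neg_right _ (hba.trans_lt ha)))
      refine ⟨w.coeff 0, mem_residueField.2 ⟨w, hw, zero_le_v_iff.2 hw0, rfl⟩, ?_⟩
      have h := coeff_mul_add hlt hw0
      rw [add_zero] at h
      rw [h, LinearMap.mulLeft_apply]
      apply Subtype.ext
      simp [ConjugatingUnits.cocycle, ConjugatingUnits.conj, d.u_one]
    exact (Submodule.finrank_mono hle).trans (Submodule.finrank_map_le _ _)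
  · have : leadingSpace L hL (rep hε σ) = ⊥ := by
      rw [eq_bot_iff]
      rintro _ ⟨x, hx, hx0, rfl⟩
      by_contra hne
      exact hσ ⟨x, hx, hne, hx0⟩
    rw [this, finrank_bot]

variable [FiniteDimensional F K]

theorem finrank_toSubalgebra_le [FiniteDimensional F (fieldCentralizer ι)]
    (hC : IsDivisionAlgebra (fieldCentralizer ι)) (hε : Function.Surjective ε)
    {L : Subring (MalcevNeumann d ε)} (hL : laurentBase d ε ≤ L) (hfield : IsField L) :
    Module.finrank (HahnSeries ε.ker F) (toSubalgebra L hL) ≤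
      Nat.card (valueGroup hε L) * Module.finrank F (residueSubalgebra L hL) := by
  classical
  obtain ⟨f, hf⟩ := exists_injective_of_leading_mem (d := d) hε (toSubalgebra L hL).toSubmodule
    (fun σ => leadingSpace L hL (rep hε σ)) (fun x hx γ hx0 => by
      have := leadingSpace_le hL γ (-⟨_, sub_rep_mem hε γ⟩)
      simp only [NegMemClass.coe_neg, neg_sub, add_sub_cancel] at this
      exact this ⟨x, hx, hx0, rfl⟩)
  have h1 := LinearMap.finrank_le_finrank_of_injective hf
  rw [Module.finrank_fintype_fun_eq_card, Fintype.card_sigma] at h1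
  simp only [Fintype.card_fin] at h1
  refine h1.trans ((Finset.sum_le_sum fun σ _ =>
    finrank_leadingSpace_le hC hε hL hfield σ).trans ?_)
  rw [Finset.sum_ite, Finset.sum_const_zero, add_zero, Finset.sum_const, smul_eq_mul,
    Nat.card_eq_fintype_card, Fintype.card_subtype]

/-- Each `σ` in `valueGroup hε L` extends from `K` to an endomorphism of the compositum over `L̄`:
conjugation by `u_σ s`, with `s` a leading coefficient from `L`. -/
theorem card_valueGroup_mul_le [FiniteDimensional F (fieldCentralizer ι)]
    (hC : IsDivisionAlgebra (fieldCentralizer ι)) (hε : Function.Surjective ε)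
    {L : Subring (MalcevNeumann d ε)} (hL : laurentBase d ε ≤ L) (hfield : IsField L)
    (hR : IsField (residueSubalgebra L hL)) (hM : IsField (compositum L)) :
    Nat.card (valueGroup hε L) * Module.finrank F (residueSubalgebra L hL) ≤
      Module.finrank F (compositum L) := by
  have hA : Nontrivial A := (hC.1.exists_pair_ne).elim fun x ⟨y, hxy⟩ =>
    ⟨x, y, fun h => hxy (Subtype.ext h)⟩
  have key : ∀ σ : valueGroup hε L, ∃ φ : fieldCentralizer ι →+* fieldCentralizer ι,
      (∀ r ∈ residueField L, φ r = r) ∧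
      ∀ (r : fieldCentralizer ι) k, ι k = r → (φ r : A) = ι ((σ : Gal(K/F)) k) := by
    rintro ⟨σ, y, hy, hne, hlt⟩
    obtain ⟨s, hs⟩ := (hC.2 _ hne).map (fieldCentralizer ι).val
    have hs' : (y.coeff (rep hε σ) : A) = s := hs.symm
    have hcomm : ∀ k, ι k * (↑(d.u σ * s) : A) = ↑(d.u σ * s) * ι (σ k) := by
      intro k
      rw [Units.val_mul, ← mul_assoc, d.comm_u, mul_assoc, mul_assoc, ← hs',
        ConjugatingUnits.mem_iff.1 (y.coeff (rep hε σ)).2]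
    refine ⟨fieldCentralizer.conjHom (d.u σ * s) σ hcomm, fun r hr => ?_, fun r k hk => ?_⟩
    · obtain ⟨x, hx, hv, rfl⟩ := mem_residueField.1 hr
      -- The leading terms of `x * y = y * x` say that the residue of `x` commutes with `u_σ s`.
      have h1 := u_mul_coeff_mul_add (zero_le_v_iff.1 hv) hlt
      have h2 := u_mul_coeff_mul_add hlt (zero_le_v_iff.1 hv)
      rw [mul_comm_of_isField hfield x hx y hy, add_comm, h2] at h1
      simp only [map_zero, toMul_zero, d.u_one, Units.val_one, one_mul, toMul_map_rep, hs'] at h1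
      apply Subtype.ext
      rw [fieldCentralizer.coe_conjHom, mul_assoc, Units.inv_mul_eq_iff_eq_mul, Units.val_mul]
      exact h1.symm
    · rw [fieldCentralizer.coe_conjHom, ← hk, mul_assoc, hcomm, Units.inv_mul_cancel_left]
  choose φ hφ hφK using key
  refine Subalgebra.card_mul_finrank_le (fun r hr => mem_compositum.2 (Subring.mem_sup_left_of_mem hr))
    hR hM φ (fun t m hm => ?_) hφ fun t t' h => ?_
  · have : residueField L ⊔ fieldInCentralizer ι ≤
        (residueField L ⊔ fieldInCentralizer ι).comap (φ t) := by
      refine sup_le (fun r hr => ?_) fun r hr => ?_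
      · rw [Subring.mem_comap, hφ t r hr]
        exact Subring.mem_sup_left_of_mem hr
      · obtain ⟨k, hk⟩ := mem_fieldInCentralizer.1 hr
        exact Subring.mem_sup_right_of_mem (mem_fieldInCentralizer.2 ⟨_, (hφK t r k hk).symm⟩)
    exact this hm
  · refine Subtype.ext (AlgEquiv.ext fun k => ι.injective (?_ : ι _ = ι _))
    let r : fieldCentralizer ι := ⟨ι k, ConjugatingUnits.mem_iff.2
      fun y => by rw [← map_mul, ← map_mul, mul_comm]⟩
    rw [← hφK t r k rfl, ← hφK t' r k rfl,
      h r (mem_compositum.2 (Subring.mem_sup_right_of_mem (mem_fieldInCentralizer.2 ⟨k, rfl⟩)))]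

theorem commute_of_mem_residueField {L : Subring (MalcevNeumann d ε)} (hL : IsField L) :
    ∀ x ∈ residueField L, ∀ y ∈ residueField L, x * y = y * x := by
  intro r hr s hs
  obtain ⟨x, hx, hvx, rfl⟩ := mem_residueField.1 hr
  obtain ⟨y, hy, hvy, rfl⟩ := mem_residueField.1 hs
  rw [← coeff_zero_mul hvx hvy, ← coeff_zero_mul hvy hvx, mul_comm_of_isField hL x hx y hy]

theorem isField_compositum [FiniteDimensional F (fieldCentralizer ι)]
    (hC : IsDivisionAlgebra (fieldCentralizer ι)) {L : Subring (MalcevNeumann d ε)}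
    (hL : IsField L) : IsField (compositum L) :=
  (compositum L).isField_of_commute hC (Subring.commute_of_mem_sup
    (commute_of_mem_residueField hL) fun _ => commute_of_mem_fieldInCentralizer)

theorem laurentBase_commute {x y : MalcevNeumann d ε} (hx : x ∈ laurentBase d ε) :
    x * y = y * x := by
  obtain ⟨z, rfl⟩ := mem_laurentBase_iff.1 hx
  exact Algebra.commutes z y

/-- `F((ker ε))` is central, and a maximal subfield of a division algebra contains everything that
commutes with it. -/
theorem laurentBase_le_of_isMaximalSubfield [FiniteDimensional F (fieldCentralizer ι)]
    (hC : IsDivisionAlgebra (fieldCentralizer ι)) (hε : Function.Surjective ε)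
    {L : Subring (MalcevNeumann d ε)} (hL : IsMaximalSubfield L) : laurentBase d ε ≤ L :=
  fun _ hx => hL.mem_of_commute (isDivisionAlgebra hC hε)
    fun _ _ => (laurentBase_commute hx).symm

theorem isMaximalSubfield_compositum [FiniteDimensional F (fieldCentralizer ι)] [IsGalois F K]
    [Algebra.IsCentral F A]
    (hC : IsDivisionAlgebra (fieldCentralizer ι)) (hε : Function.Surjective ε)
    {L : Subring (MalcevNeumann d ε)} (hL : IsMaximalSubfield L) :
    IsMaximalSubfield (residueField L ⊔ fieldInCentralizer ι) := by
  have hbase := laurentBase_le_of_isMaximalSubfield hC hε hL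
  have hM := isField_compositum hC hL.prop
  have hR : IsField (residueSubalgebra L hbase) :=
    (residueSubalgebra L hbase).isField_of_commute hC (commute_of_mem_residueField hL.prop)
  refine ⟨hM, fun M hMfield hle => ?_⟩
  let M' : Subalgebra F (fieldCentralizer ι) :=
    { M with algebraMap_mem' := fun c =>
          hle (Subring.mem_sup_right_of_mem (algebraMap_mem_fieldInCentralizer c)) }
  have hupper := d.sq_finrank_le hC M' ((le_sup_right : fieldInCentralizer ι ≤ _).trans hle) hMfield
  have := finiteDimensional (d := d) hε
  have hlower := (isDivisionAlgebra (d := d) hC hε).finrank_le_sq (toSubalgebra L hbase) hL.prop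
    fun c hc => hL.mem_of_commute (isDivisionAlgebra hC hε) hc
  -- The intermediate terms are `|G| [C_A(K) : F]`, the degree of the Malcev-Neumann ring over
  -- `F((ker ε))`, and the square of the degree of `L`.
  have hle2 : Module.finrank F M' ^ 2 ≤ Module.finrank F (compositum L) ^ 2 :=
    calc _ ≤ _ := hupper
      _ ≤ _ := card_mul_finrank_le_finrank (d := d) hε
      _ ≤ _ := hlower
      _ ≤ _ := Nat.pow_le_pow_left ((finrank_toSubalgebra_le hC hε hbase hL.prop).trans
        (card_valueGroup_mul_le hC hε hbase hL.prop hR hM)) 2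
  have hle1 := (Nat.pow_le_pow_iff_left two_ne_zero).1 hle2
  have heq : compositum L = M' := Subalgebra.eq_of_le_of_finrank_le hle hle1
  intro r hr
  have : r ∈ M' := hr
  rwa [← heq] at this

end MalcevNeumann

end Residue

/-! ### Normality of the residue field -/

open Polynomial in
/-- Roots of the minimal polynomial over the centre of a division algebra are conjugate. -/
theorem IsDivisionAlgebra.exists_conjugating {Z D E : Type*} [Field Z] [Ring D] [Algebra Z D]
    [Field E] [Algebra Z E] (hD : IsDivisionAlgebra D)
    (hcenter : ∀ c : D, (∀ x, x * c = c * x) → c ∈ Set.range (algebraMap Z D))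
    (f : E →ₐ[Z] D) {x x' : E} (hx : IsIntegral Z x) (hx' : aeval x' (minpoly Z x) = 0) :
    ∃ c : D, c ≠ 0 ∧ c * f x = f x' * c := by
  have := hD.1
  let : Module E D := Module.compHom D f.toRingHom
  have hsmul : ∀ (e : E) (y : D), e • y = f e * y := fun _ _ => rfl
  -- Right multiplication by `f x` is linear for the left action of `E`, so polynomials over `E` can
  -- be evaluated at it.
  let R : Module.End E D :=
    { toFun := fun y => y * f x
      map_add' := fun _ _ => add_mul _ _ _
      map_smul' := fun e y => mul_assoc (f e) y (f x) }
  have hRpow : ∀ (i : ℕ) (b : D), (R ^ i) b = b * f x ^ i := by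
    intro i b
    induction i with
    | zero => simp
    | succ i ih =>
      rw [pow_succ', Module.End.mul_apply, ih, pow_succ, ← mul_assoc]
      rfl
  let p := minpoly Z x
  have hp : p.Monic := minpoly.monic hx
  let q := p.map (algebraMap Z E) /ₘ (X - C x')
  have hq : (X - C x') * q = p.map (algebraMap Z E) :=
    mul_divByMonic_eq_iff_isRoot.2 (by rwa [IsRoot, eval_map_algebraMap])
  have hqm : q.Monic := (monic_X_sub_C x').of_mul_monic_left (hq ▸ hp.map _)
  have hdeg : q.natDegree < p.natDegree := by
    have := congrArg natDegree hq
    rw [(monic_X_sub_C x').natDegree_mul hqm, natDegree_X_sub_C, hp.natDegree_map] at this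
    omega
  -- Were `q(R) = 0`, the shortest-relation argument would give a relation over the centre between
  -- powers of `x` below the degree of its minimal polynomial.
  have hne : ∃ b, aeval R q b ≠ 0 := by
    by_contra! h0
    have hq0 : (fun i : Fin p.natDegree => f (q.coeff i)) ≠ 0 := by
      intro h
      have := congrFun h ⟨q.natDegree, hdeg⟩
      simp [hqm.coeff_natDegree] at this
    have hvan : ∀ b ∈ (⊤ : Subring D),
        ∑ i : Fin p.natDegree, f (q.coeff i) * b * f x ^ (i : ℕ) = 0 := by
      intro b _
      rw [← h0 b, aeval_eq_sum_range' hdeg, Finset.sum_range, LinearMap.sum_apply]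
      refine Finset.sum_congr rfl fun i _ => ?_
      rw [LinearMap.smul_apply, hRpow, hsmul, mul_assoc]
    obtain ⟨e, he, hcomm, hsum⟩ := hD.exists_centralizing_relation ⊤ _ _ hq0 hvan
    choose z hz using fun i => hcenter (e i) fun y => hcomm i y trivial
    have hli := Fintype.linearIndependent_iff.1 (linearIndependent_pow (K := Z) x) z
      (f.injective (by simpa [← hz, Algebra.smul_def] using hsum))
    exact he (funext fun i => by rw [← hz, hli, map_zero]; rfl)
  obtain ⟨b, hb⟩ := hne
  refine ⟨aeval R q b, hb, sub_eq_zero.1 ?_⟩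
  -- `p(R)` is right multiplication by `f (p x) = 0`, so `R - x'` kills `q(R) b`; this is the
  -- conjugation relation.
  have h1 : aeval R (p.map (algebraMap Z E)) b = 0 := by
    have h2 : f (aeval x p) = 0 := by rw [minpoly.aeval, map_zero]
    rw [aeval_eq_sum_range, map_sum] at h2
    rw [aeval_eq_sum_range, LinearMap.sum_apply, hp.natDegree_map, ← mul_zero b, ← h2,
      Finset.mul_sum]
    refine Finset.sum_congr rfl fun i _ => ?_
    rw [LinearMap.smul_apply, hRpow, hsmul, coeff_map, f.commutes, map_smul, map_pow,
      Algebra.smul_def, ← mul_assoc, ← mul_assoc, Algebra.commutes]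
  rw [← h1, ← hq, map_mul, Module.End.mul_apply, map_sub, aeval_X, aeval_C,
    LinearMap.sub_apply, Module.algebraMap_end_apply]
  rfl

section Normal

open Polynomial

variable {F K A : Type*} [Field F] [Field K] [Algebra F K] [Ring A] [Algebra F A]
variable {Γ : Type*} [AddCommGroup Γ] [LinearOrder Γ] [IsOrderedAddMonoid Γ]
variable {ι : K →ₐ[F] A} {d : ConjugatingUnits ι} {ε : Γ →+ Additive Gal(K/F)}
variable [IsMulCommutative Gal(K/F)]

namespace MalcevNeumann

/-- Values add under multiplication and `Γ` is abelian, so conjugate elements have the same value.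
-/
theorem zero_le_v_of_conjugate (hC : IsDivisionAlgebra (fieldCentralizer ι))
    {x x' c : MalcevNeumann d ε} (hc : c ≠ 0) (h : c * x = x' * c) (hx : 0 ≤ x.v) :
    0 ≤ x'.v := by
  rw [zero_le_v_iff]
  intro a ha
  by_contra hne
  have hx'0 : x' ≠ 0 := fun h => hne (by rw [h]; rfl)
  obtain ⟨γ, hγ, hlt⟩ := exists_leading hx'0
  obtain ⟨δ, hδ, hltδ⟩ := exists_leading hc
  have hγa : γ ≤ a := not_lt.1 fun h => hne (hlt a h)
  refine coeff_mul_add_ne_zero hC hlt hltδ hγ hδ ?_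
  rw [← h, add_comm]
  exact coeff_mul_eq_zero hltδ (zero_le_v_iff.1 hx) _ (by
    simpa using hγa.trans_lt ha)

variable [FiniteDimensional F K]

theorem normal_residueSubalgebra [FiniteDimensional F (fieldCentralizer ι)] [IsGalois F K]
    [Algebra.IsCentral F A] (hC : IsDivisionAlgebra (fieldCentralizer ι))
    (hε : Function.Surjective ε) {L : Subring (MalcevNeumann d ε)} (hL : laurentBase d ε ≤ L)
    (hG : IsGaloisSubextension (laurentBase d ε) L) (hR : IsField (residueSubalgebra L hL)) :
    letI := hR.toField
    Normal F (residueSubalgebra L hL) := by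
  let : Field (residueSubalgebra L hL) := hR.toField
  obtain ⟨hle, hZ, hLf, hgal⟩ := hG
  let : Field (laurentBase d ε) := hZ.toField
  let : Field L := hLf.toField
  let : Algebra (laurentBase d ε) L := (Subring.inclusion hle).toAlgebra
  have hgal' : IsGalois (laurentBase d ε) L := hgal
  let : Algebra (laurentBase d ε) (MalcevNeumann d ε) :=
    (laurentBase d ε).subtype.toAlgebra' fun c x => laurentBase_commute c.2
  let f : L →ₐ[laurentBase d ε] MalcevNeumann d ε :=
    { L.subtype with commutes' := fun _ => rfl }
  refine normal_iff.2 fun r => ⟨Algebra.IsIntegral.isIntegral r, ?_⟩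
  obtain ⟨x, hx, hvx, hxr⟩ := mem_residueField.1 r.2
  let O : Subring L := (valuationRing d ε).comap L.subtype
  let ρ : O →+* residueSubalgebra L hL :=
    { toFun := fun y => ⟨(y : MalcevNeumann d ε).coeff 0,
        mem_residueField.2 ⟨y, y.1.2, y.2, rfl⟩⟩
      map_zero' := rfl
      map_one' := Subtype.ext (by simp [coeff_one])
      map_add' := fun _ _ => rfl
      map_mul' := fun y z => Subtype.ext (coeff_zero_mul y.2 z.2) }
  let x₁ : L := ⟨x, hx⟩
  have hint : IsIntegral (laurentBase d ε) x₁ := Algebra.IsIntegral.isIntegral x₁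
  let p := (minpoly (laurentBase d ε) x₁).map (algebraMap (laurentBase d ε) L)
  have hp : p.Monic := (minpoly.monic hint).map _
  have hsplit : p.Splits := Normal.splits inferInstance x₁
  have hroots : ∀ a ∈ p.roots, a ∈ O := by
    intro a ha
    obtain ⟨c, hc, hconj⟩ := (isDivisionAlgebra (d := d) hC hε).exists_conjugating
      (fun c hc => ⟨⟨c, mem_laurentBase_of_commute hε hc⟩, rfl⟩) f (x' := a) hint
      (by rw [← eval_map_algebraMap]; exact (mem_roots'.1 ha).2)
    exact zero_le_v_of_conjugate hC hc hconj hvx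
  -- With all roots in the valuation ring `O` of `L`, the minimal polynomial factors over `O` and
  -- can be reduced factor by factor.
  obtain ⟨t, ht⟩ : ∃ t : Multiset O, t.map O.subtype = p.roots :=
    ⟨p.roots.pmap (fun a h => ⟨a, h⟩) hroots, by
      rw [Multiset.map_pmap]
      exact (Multiset.pmap_eq_map _ id _ hroots).trans (Multiset.map_id _)⟩
  let P : O[X] := (t.map fun a => X - C a).prod
  have hP : P.map O.subtype = p := by
    rw [hsplit.eq_prod_roots_of_monic hp, ← ht]
    simp [P, Polynomial.map_multiset_prod, Multiset.map_map]
  -- The coefficients of `P` are series in `F((ker ε))`, so their residues lie in `F`.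
  have hlift : P.map ρ ∈ Polynomial.lifts (algebraMap F (residueSubalgebra L hL)) := by
    rw [Polynomial.lifts_iff_coeff_lifts]
    intro n
    have h1 : (((P.coeff n : O) : L) : MalcevNeumann d ε) ∈ laurentBase d ε := by
      have := congrArg (fun g => g.coeff n) hP
      simp only [coeff_map, p] at this
      have h2 := congrArg Subtype.val this
      exact h2 ▸ ((minpoly (laurentBase d ε) x₁).coeff n).2
    obtain ⟨c, hc⟩ := (h1 0).1
    exact ⟨c, by rw [coeff_map]; exact Subtype.ext hc⟩
  obtain ⟨q, hq⟩ := (Polynomial.mem_lifts _).1 hlift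
  have hPρ : P.map ρ = ((t.map ρ).map fun a => X - C a).prod := by
    simp [P, Polynomial.map_multiset_prod, Multiset.map_map]
  have hmonic : (P.map ρ).Monic := by
    rw [hPρ]
    exact monic_multiset_prod_of_monic _ _ fun a _ => monic_X_sub_C a
  have hsplit' : (P.map ρ).Splits := by
    rw [hPρ]
    refine Splits.multisetProd fun g hg => ?_
    obtain ⟨a, -, rfl⟩ := Multiset.mem_map.1 hg
    exact Splits.X_sub_C a
  let x₀ : O := ⟨x₁, hvx⟩
  have hroot : P.eval x₀ = 0 := by
    apply Subtype.val_injective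
    have h1 : p.eval x₁ = 0 := by rw [eval_map_algebraMap, minpoly.aeval]
    rw [← hP] at h1
    have h2 : (P.map O.subtype).eval (O.subtype x₀) = 0 := h1
    rw [eval_map_apply] at h2
    exact h2
  have hρx : ρ x₀ = r := Subtype.ext hxr
  have hqr : aeval r q = 0 := by
    rw [← eval_map_algebraMap, hq, ← hρx, eval_map_apply, hroot, map_zero]
  exact hsplit'.of_dvd hmonic.ne_zero (hq ▸ Polynomial.map_dvd _ (minpoly.dvd F r hqr))

end MalcevNeumann

end Normal

/-! ### Separability and the Galois property of the compositum -/

/-- A finite extension of degree prime to the characteristic is separable. -/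
theorem Algebra.isSeparable_of_not_ringChar_dvd (F E : Type*) [Field F] [Field E] [Algebra F E]
    [FiniteDimensional F E] (h : ¬ ringChar F ∣ Module.finrank F E) : Algebra.IsSeparable F E := by
  rw [isSeparable_iff_finInsepDegree_eq_one]
  obtain ⟨n, hn⟩ := finInsepDegree_eq_pow F E (ringExpChar F)
  rcases Nat.eq_zero_or_pos n with rfl | hpos
  · simpa using hn
  · rcases (expChar_is_prime_or_one F (ringExpChar F)).symm with h1 | hprime
    · rw [hn, h1, one_pow]
    · exfalso
      -- A prime exponential characteristic exceeds the default `1`, so it is the characteristic; it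
      -- divides the inseparable degree when `n > 0`.
      have h2 : ringExpChar F = max (ringChar F) 1 := rfl
      have h3 : ringChar F = ringExpChar F := by
        have := hprime.two_le
        omega
      apply h
      rw [h3, ← Field.finSepDegree_mul_finInsepDegree F E, hn]
      exact Dvd.dvd.mul_left (dvd_pow_self _ hpos.ne') _

section Galois

variable {F K A : Type*} [Field F] [Field K] [Algebra F K] [Ring A] [Algebra F A]
variable {Γ : Type*} [AddCommGroup Γ] [LinearOrder Γ] [IsOrderedAddMonoid Γ]
variable {ι : K →ₐ[F] A} {d : ConjugatingUnits ι} {ε : Γ →+ Additive Gal(K/F)}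
variable [IsMulCommutative Gal(K/F)] [FiniteDimensional F K]

namespace MalcevNeumann

theorem residueDegree_eq {L : Subring (MalcevNeumann d ε)} (hL : laurentBase d ε ≤ L) :
    residueDegree L = Module.finrank F (residueSubalgebra L hL) := by
  have : Submodule.span F (residueField L : Set (fieldCentralizer ι)) =
      (residueSubalgebra L hL).toSubmodule := SetLike.coe_injective (coe_span_residueField hL)
  rw [residueDegree, this]
  rfl

theorem isGalois_compositum [FiniteDimensional F (fieldCentralizer ι)] [IsGalois F K]
    [Algebra.IsCentral F A] (hC : IsDivisionAlgebra (fieldCentralizer ι))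
    (hε : Function.Surjective ε) {L : Subring (MalcevNeumann d ε)}
    (hG : IsGaloisSubextension (laurentBase d ε) L)
    (hchar : ¬ ringChar F ∣ residueDegree L) (hM : IsField (compositum L)) :
    letI := hM.toField
    IsGalois F (compositum L) := by
  let : Field (compositum L) := hM.toField
  obtain ⟨hL, -, hLf, -⟩ := id hG
  have hR : IsField (residueSubalgebra L hL) :=
    (residueSubalgebra L hL).isField_of_commute hC (commute_of_mem_residueField hLf)
  let : Field (residueSubalgebra L hL) := hR.toField
  have : Normal F (residueSubalgebra L hL) := normal_residueSubalgebra hC hε hL hG hR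
  have : Algebra.IsSeparable F (residueSubalgebra L hL) :=
    Algebra.isSeparable_of_not_ringChar_dvd _ _ (residueDegree_eq hL ▸ hchar)
  have : IsGalois F (residueSubalgebra L hL) := ⟨⟩
  let i : residueSubalgebra L hL →ₐ[F] compositum L :=
    Subalgebra.inclusion fun _ h => mem_compositum.2 (Subring.mem_sup_left_of_mem h)
  let j : K →ₐ[F] compositum L :=
    { toFun := fun k => ⟨⟨ι k, ConjugatingUnits.mem_iff.2
        fun y => by rw [← map_mul, ← map_mul, mul_comm]⟩,
          mem_compositum.2 (Subring.mem_sup_right_of_mem (mem_fieldInCentralizer.2 ⟨k, rfl⟩))⟩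
      map_zero' := Subtype.ext (Subtype.ext (map_zero ι))
      map_one' := Subtype.ext (Subtype.ext (map_one ι))
      map_add' := fun _ _ => Subtype.ext (Subtype.ext (map_add ι _ _))
      map_mul' := fun _ _ => Subtype.ext (Subtype.ext (map_mul ι _ _))
      commutes' := fun _ => Subtype.ext (Subtype.ext (ι.commutes _)) }
  have hi : IsGalois F i.fieldRange := IsGalois.of_algEquiv (AlgEquiv.ofInjectiveField i)
  have hj : IsGalois F j.fieldRange := IsGalois.of_algEquiv (AlgEquiv.ofInjectiveField j)
  -- The compositum is generated already as a ring by `L̄` and `K`, so the join of the two Galois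
  -- subextensions is everything.
  have htop : i.fieldRange ⊔ j.fieldRange = ⊤ := by
    rw [eq_top_iff]
    rintro ⟨m, hm⟩ -
    let N : Subring (fieldCentralizer ι) :=
      (i.fieldRange ⊔ j.fieldRange).toSubring.map (compositum L).val.toRingHom
    have hN : residueField L ⊔ fieldInCentralizer ι ≤ N := by
      refine sup_le (fun r hr => ?_) fun r hr => ?_
      · exact ⟨i ⟨r, hr⟩, (le_sup_left : i.fieldRange ≤ _) ⟨_, rfl⟩, rfl⟩
      · obtain ⟨k, hk⟩ := mem_fieldInCentralizer.1 hr
        exact ⟨j k, (le_sup_right : j.fieldRange ≤ _) ⟨_, rfl⟩, Subtype.ext hk⟩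
    obtain ⟨m', hm', heq⟩ := hN hm
    have : m' = ⟨m, hm⟩ := Subtype.ext heq
    exact this ▸ hm'
  have : IsGalois F (i.fieldRange ⊔ j.fieldRange : IntermediateField F (compositum L)) :=
    ⟨⟩
  rw [htop] at this
  exact isGalois_iff_isGalois_top.1 this

end MalcevNeumann

end Galois

/-! ### The two assertions combined -/

theorem proposition1p4
    {F K A Γ : Type*} [Field F]
    [Ring A] [Algebra F A] [Algebra.IsCentral F A] [IsSimpleRing A] [FiniteDimensional F A]
    [Field K] [Algebra F K] [IsGalois F K] [IsMulCommutative Gal(K/F)]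
    (ι : K →ₐ[F] A)
    [AddCommGroup Γ] [LinearOrder Γ] [IsOrderedAddMonoid Γ]
    (ε : Γ →+ Additive Gal(K/F)) (hε : Function.Surjective ε)
    (d : ConjugatingUnits ι)
    (hC : IsDivisionAlgebra (fieldCentralizer ι))
    (L : Subring (MalcevNeumann d ε)) (hL : IsMaximalSubfield L) :
    IsMaximalSubfield (MalcevNeumann.residueField L ⊔ fieldInCentralizer ι) ∧
    (IsGaloisSubextension (MalcevNeumann.laurentBase d ε) L →
      ¬ ringChar F ∣ MalcevNeumann.residueDegree L →
      IsGaloisSubextension (baseInCentralizer ι)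
        (MalcevNeumann.residueField L ⊔ fieldInCentralizer ι)) := by
  have : FiniteDimensional F K := FiniteDimensional.of_injective ι.toLinearMap ι.injective
  refine ⟨MalcevNeumann.isMaximalSubfield_compositum hC hε hL, fun hG hchar => ?_⟩
  have := hC.1
  let e : F ≃+* baseInCentralizer ι :=
    RingEquiv.ofBijective (algebraMap F (fieldCentralizer ι)).rangeRestrict
      ⟨fun a b h => (algebraMap F (fieldCentralizer ι)).injective (congrArg Subtype.val h),
        (algebraMap F (fieldCentralizer ι)).rangeRestrict_surjective⟩
  have hM := MalcevNeumann.isField_compositum hC hL.prop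
  have hk : IsField (baseInCentralizer ι) := e.symm.toMulEquiv.isField (Field.toIsField F)
  have hle : baseInCentralizer ι ≤ MalcevNeumann.residueField L ⊔ fieldInCentralizer ι := by
    rintro _ ⟨c, rfl⟩
    exact Subring.mem_sup_right_of_mem (algebraMap_mem_fieldInCentralizer c)
  have hM' : IsField (MalcevNeumann.residueField L ⊔ fieldInCentralizer ι : Subring _) := hM
  refine ⟨hle, hk, hM', ?_⟩
  let : Field (MalcevNeumann.compositum L) := hM.toField
  have hgal : IsGalois F (MalcevNeumann.compositum L) :=
    MalcevNeumann.isGalois_compositum hC hε hG hchar hM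
  -- Replace `F` by its isomorphic image in `C_A(K)`, keeping the same upper field.
  exact @IsGalois.of_equiv_equiv F (MalcevNeumann.compositum L) _ _ _
    (baseInCentralizer ι) (MalcevNeumann.residueField L ⊔ fieldInCentralizer ι : Subring _)
    hM'.toField hk.toField
    (let := hk.toField; let := hM'.toField; RingHom.toAlgebra (Subring.inclusion hle))
    hgal e (RingEquiv.refl _) (RingHom.ext fun _ => rfl)
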